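/- **Setting.** For a finite simple graph $G=(V,E)$ let $\mathscr D_G$ be the set of its dimeric configurations (sets $D\subseteq E$ of pairwise disjoint edges), let $Z_G(z)=\sum_{D\in\mathscr D_G}z^{|V|-2|D|}$, and for $o\in V$ let $$\mathcal R_z(G,o)=\frac{1}{Z_G(z)}\sum_{D\in\mathscr D_G,\ o\text{ not covered by }D}z^{|V|-2|D|}.$$ Let $\mathbb H_+=\{z\in\mathbb C:\Re z>0\}$. On $\mathbb H_+$, $\log Z_G$ denotes the holomorphic branch of the logarithm of $Z_G$ that is real on $(0,\infty)$. For probability distributions $P,\rho$ on $\mathbb N$, let $\mathcal T(P,\rho)$ be the Galton–Watson tree with root $o$ whose vertices have independent offspring numbers, with law $P$ at the root and law $\rho$ at all other vertices; $\mathcal T(P,\rho,r)$ is the subtree of its first $r$ generations. It is unimodular if $\overline P=\sum_k kP_k<\infty$ and $\overline P\,\rho_k=(k+1)P_{k+1}$ for all $k\ge 0$. Let $[G,v]_r$ be the subgraph of $G$ induced by the vertices at distance at most $r$ from $v$, rooted at $v$. Random finite (nonempty) simple graphs $G_n=(V_n,E_n)$, $n\in\mathbb N$, converge locally to $\mathcal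 T(P,\rho)$ if for every $r\in\mathbb N$ and every finite rooted tree $(T,o)$ with at most $r$ generations $$\frac1{|V_n|}\sum_{v\in V_n}\mathbf 1\big(([G_n,v]_r,v)\cong(T,o)\big)\xrightarrow[n\to\infty]{\text{a.s.}}\mathbb P\big((\mathcal T(P,\rho,r),o)\cong(T,o)\big),$$ where $\cong$ is isomorphism of rooted graphs. **Statement.** Suppose that the random finite simple graphs $(G_n)_{n\in\mathbb N}$ converge locally to the unimodular Galton–Watson tree $\mathcal T(P,\rho)$ and that $P$ has finite second moment. Almost surely the limit $Y(z)=\lim_{r\to\infty}\mathcal R_z(\mathcal T(P,\rho,r),o)$ exists for all $z\in\mathbb H_+$, and $Y(z)$ is integrable for every $z\in\mathbb H_+$. Almost surely, for all $z\in\mathbb H_+$, $$\varepsilon_{G_n}(z)=z\,\frac{\mathrm d}{\mathrm dz}\frac{\log Z_{G_n}(z)}{|V_n|}=\frac1{|V_n|}\sum_{v\in V_n}\mathcal R_z(G_n,v)\xrightarrow[n\to\infty]{}\mathbb E[Y(z)].$$ Almost surely the convergence is uniform on compact subsets of $\mathbb H_+$, and the function $z\mapsto\mathbb E[Y(z)]$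 is analytic on $\mathbb H_+$. Moreover, almost surely, for all $k\ge1$ and all $z\in\mathbb H_+$, $$\frac{\mathrm d^k}{\mathrm dz^k}\frac{\log Z_{G_n}(z)}{|V_n|}\xrightarrow[n\to\infty]{}\frac{\mathrm d^{k-1}}{\mathrm dz^{k-1}}\frac{\mathbb E[Y(z)]}{z}.$$ -/

import Mathlib

open MeasureTheory ProbabilityTheory Filter Topology
open scoped ENNReal

namespace MonomerDimer

/-! ### The monomer-dimer model on a finite graph -/

section Model

variable {V : Type*} [Fintype V]

open Classical in
/-- Dimeric configurations: sets of edges, no two of which share a vertex. -/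
noncomputable def dimericConfigs (G : SimpleGraph V) : Finset (Finset (Sym2 V)) :=
  Finset.univ.filter fun D =>
    (∀ e ∈ D, e ∈ G.edgeSet) ∧ ∀ e ∈ D, ∀ f ∈ D, e ≠ f → ∀ v, ¬ (v ∈ e ∧ v ∈ f)

open Classical in
/-- The monomeric configuration of `D`: the vertices that are free of dimers. -/
noncomputable def monomers (D : Finset (Sym2 V)) : Finset V :=
  Finset.univ.filter fun v => ∀ u : V, s(u, v) ∉ D

/-- Counting vertices: `|V| = |monomers| + 2 |dimers|`, so that the subtraction in the exponents
below is never truncated. -/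
theorem card_monomers_add (G : SimpleGraph V) (D : Finset (Sym2 V)) (hD : D ∈ dimericConfigs G) :
    (monomers D).card + 2 * D.card = Fintype.card V := by
  classical
  simp only [dimericConfigs, Finset.mem_filter, Finset.mem_univ, true_and] at hD
  obtain ⟨hE, hM⟩ := hD
  have h1 : (monomers D)ᶜ = D.biUnion Sym2.toFinset := by
    ext v
    simp only [monomers, Finset.mem_compl, Finset.mem_filter, Finset.mem_univ, true_and,
      not_forall, not_not, Finset.mem_biUnion, Sym2.mem_toFinset]
    constructor
    · rintro ⟨u, hu⟩
      exact ⟨_, hu, Sym2.mem_mk_right u v⟩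
    · rintro ⟨e, he, hv⟩
      obtain ⟨u, rfl⟩ := hv
      exact ⟨u, by rwa [Sym2.eq_swap]⟩
  have h2 : (D.biUnion Sym2.toFinset).card = 2 * D.card := by
    rw [Finset.card_biUnion, Finset.sum_const_nat (m := 2), mul_comm]
    · intro e he
      exact Sym2.card_toFinset_of_not_isDiag e (G.not_isDiag_of_mem_edgeSet (hE e he))
    · intro e he f hf hef
      rw [Function.onFun, Finset.disjoint_left]
      intro v hv hv'
      rw [Sym2.mem_toFinset] at hv hv'
      exact hM e he f hf hef v ⟨hv, hv'⟩
  rw [← h2, ← h1, Finset.card_add_card_compl]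

/-- The partition function `Z_G(x) = ∑_D x ^ (|V| - 2 |D|)`, at a real or complex activity `x`. -/
noncomputable def partitionFunction {R : Type*} [Field R] (G : SimpleGraph V) (x : R) : R :=
  ∑ D ∈ dimericConfigs G, x ^ (Fintype.card V - 2 * D.card)

open Classical in
/-- `R_x(G, o)`: the (possibly complex) Gibbs weight `∑_D 1(o is a monomer of D) μ_{G,x}(D)` of the
event that there is a monomer on `o`. -/
noncomputable def monomerProb {R : Type*} [Field R] (G : SimpleGraph V) (x : R) (o : V) : R :=
  ∑ D ∈ dimericConfigs G,
    if o ∈ monomers D then x ^ (Fintype.card V - 2 * D.card) / partitionFunction G x else 0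

/-- The monomer density `ε_G(z) = |V|⁻¹ ∑_v R_z(G, v)`. -/
noncomputable def monomerDensity (G : SimpleGraph V) (z : ℂ) : ℂ :=
  (∑ v : V, monomerProb G z v) / (Fintype.card V : ℂ)

end Model

/-- The open right half-plane. -/
def rightHalfPlane : Set ℂ := {z | 0 < z.re}

/-- `L` is the pressure `log Z_G` on the right half-plane: the holomorphic branch of the logarithm
of `Z_G` that takes its usual real value on the positive half-line. -/
structure IsLogPartition {V : Type*} [Fintype V] (G : SimpleGraph V) (L : ℂ → ℂ) : Prop where
  holo : DifferentiableOn ℂ L rightHalfPlane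
  exp_eq : ∀ z ∈ rightHalfPlane, Complex.exp (L z) = partitionFunction G z
  real : ∀ x : ℝ, 0 < x → L (x : ℂ) = ((Real.log (partitionFunction G x) : ℝ) : ℂ)

/-! ### Rooted graphs and balls -/

/-- Isomorphism of the rooted graphs `(G, o)` and `(H, p)`. -/
def RootedIso {V W : Type*} (G : SimpleGraph V) (o : V) (H : SimpleGraph W) (p : W) : Prop :=
  ∃ e : G ≃g H, e o = p

/-- Vertex set of the ball `[G, v]_r` (the extended distance, so that vertices in other components
are at distance `⊤`). -/
def ballSet {V : Type*} (G : SimpleGraph V) (v : V) (r : ℕ) : Set V :=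
  {u | G.edist v u ≤ (r : ℕ∞)}

/-- The ball `[G, v]_r` as an induced subgraph. -/
def ball {V : Type*} (G : SimpleGraph V) (v : V) (r : ℕ) : SimpleGraph (ballSet G v r) :=
  G.induce (ballSet G v r)

/-- The root of the ball `[G, v]_r`. -/
def ballRoot {V : Type*} (G : SimpleGraph V) (v : V) (r : ℕ) : ballSet G v r :=
  ⟨v, by simp [ballSet]⟩

/-! ### Galton-Watson trees

Vertices are words: the root is `[]`, and the offspring of the vertex `u` are `i :: u` for
`i < N u`, where `N u` is the number of offspring of `u`. -/

/-- `w` is a vertex of the tree with offspring numbers `N`. -/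
def IsNode (N : List ℕ → ℕ) : List ℕ → Prop
  | [] => True
  | i :: u => i < N u ∧ IsNode N u

/-- Vertices in the first `r` generations (the root being generation `0`). -/
def TreeVertex (N : List ℕ → ℕ) (r : ℕ) : Type := {w : List ℕ // IsNode N w ∧ w.length ≤ r}

theorem finite_nodes (N : List ℕ → ℕ) (r : ℕ) : {w | IsNode N w ∧ w.length ≤ r}.Finite := by
  induction r with
  | zero =>
    refine (Set.finite_singleton []).subset ?_
    rintro w ⟨-, hw⟩
    simpa using hw
  | succ r ih =>
    refine ((Set.finite_singleton []).union
      (ih.biUnion fun u _ => (Set.finite_Iio (N u)).image fun i => i :: u)).subset ?_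
    rintro (_ | ⟨i, u⟩) ⟨hw, hl⟩
    · simp
    · refine Or.inr (Set.mem_biUnion (x := u) ⟨hw.2, ?_⟩ ⟨i, hw.1, rfl⟩)
      simpa using hl

noncomputable instance (N : List ℕ → ℕ) (r : ℕ) : Fintype (TreeVertex N r) :=
  (finite_nodes N r).fintype

/-- The tree with offspring numbers `N`, cut after the first `r` generations. -/
def truncTree (N : List ℕ → ℕ) (r : ℕ) : SimpleGraph (TreeVertex N r) where
  Adj a b := (∃ i, a.1 = i :: b.1) ∨ ∃ i, b.1 = i :: a.1
  symm := ⟨fun _ _ h => h.symm⟩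
  loopless := ⟨fun a h => by
    rcases h with ⟨i, hi⟩ | ⟨i, hi⟩ <;> simpa using congrArg List.length hi⟩

/-- The root. -/
def treeRoot (N : List ℕ → ℕ) (r : ℕ) : TreeVertex N r := ⟨[], trivial, Nat.zero_le r⟩

/-- The random offspring numbers `N` of a Galton-Watson tree `T(P, ρ)`: independent, with law `P`
at the root and law `ρ` at every other vertex. -/
structure IsGaltonWatson {Ω : Type*} [MeasurableSpace Ω] (μ : Measure Ω)
    (N : Ω → List ℕ → ℕ) (P ρ : PMF ℕ) : Prop where
  measurable : ∀ w, Measurable fun ω => N ω w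
  indep : iIndepFun (fun w ω => N ω w) μ
  law_root : μ.map (fun ω => N ω []) = P.toMeasure
  law_other : ∀ w, w ≠ [] → μ.map (fun ω => N ω w) = ρ.toMeasure

/-- The mean of a distribution on `ℕ`. -/
noncomputable def pmfMean (P : PMF ℕ) : ℝ≥0∞ := ∑' k : ℕ, (k : ℝ≥0∞) * P k

/-- `T(P, ρ)` is unimodular: `P` has a finite mean and `ρ_k = (k + 1) P_{k+1} / mean P`, cleared of
the denominator (so that `P = δ_0` is allowed, where `ρ` plays no role). -/
def IsUnimodular (P ρ : PMF ℕ) : Prop :=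
  pmfMean P ≠ ⊤ ∧ ∀ k : ℕ, pmfMean P * ρ k = ((k : ℝ≥0∞) + 1) * P (k + 1)

/-- `Y(z) = lim_r R_z(T(r), o)` on the tree with offspring numbers `N`. -/
noncomputable def treeLimit (N : List ℕ → ℕ) (z : ℂ) : ℂ :=
  limUnder atTop fun r : ℕ => monomerProb (truncTree N r) z (treeRoot N r)

/-- Local convergence of the random graphs `G n` to the random tree with offspring numbers `N`: for
every `r` and every finite rooted tree `(T, o)` with at most `r` generations, almost surely the
fraction of vertices `v` with `[G n, v]_r ≅ (T, o)` tends to the probability that the tree cut after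
`r` generations is isomorphic to `(T, o)`. -/
def LocallyConverges {Ω : Type*} [MeasurableSpace Ω] (μ : Measure Ω)
    {V : ℕ → Ω → Type*} [∀ n ω, Fintype (V n ω)] (G : ∀ n ω, SimpleGraph (V n ω))
    {Ω' : Type*} [MeasurableSpace Ω'] (μ' : Measure Ω') (N : Ω' → List ℕ → ℕ) : Prop :=
  ∀ (r m : ℕ) (T : SimpleGraph (Fin m)) (o : Fin m), T.IsTree → (∀ v, T.edist o v ≤ (r : ℕ∞)) →
    ∀ᵐ ω ∂μ, Tendsto
      (fun n => (Nat.card {v : V n ω //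
          RootedIso (ball (G n ω) v r) (ballRoot (G n ω) v r) T o} : ℝ) / Fintype.card (V n ω))
      atTop
      (𝓝 (μ'.real {ω' | RootedIso (truncTree (N ω') r) (treeRoot (N ω') r) T o}))

end MonomerDimer

namespace MonomerDimer

/-! Sorting dimeric configurations by the partner of $o$ gives the Heilmann–Lieb recursion for
$q(S,o)=Z_{S\setminus o}/Z_S$, namely $q(S,o)=(z+\sum_{v\sim o}q(S\setminus o,v))^{-1}$. The right
half-plane is stable under sums and inversion, so by induction $Z_S\ne0$ there, every ratio has
positive real part, and $|q|\le1/\Re z$ (`partitionOn_ne_zero_and_monomerRec`,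
`norm_monomerRec_le`). Hence $|\mathcal R_z|\le|z|/\Re z$ on every finite graph. Unfolded, the
recursion runs over self-avoiding paths from $o$; its first $r$ steps see only the ball of radius
$r$, and on a tree they run through the descendants.

Stopping after $r$ steps costs at most $\frac2{\Re z}(\Re z)^{-2r}$ times the number of
self-avoiding paths of length $r$ (`norm_monomerRec_sub_le`). On the Galton–Watson tree this number
is the size of generation $r$, whose mean grows at most geometrically because unimodularity and the
second moment of $P$ control the mean of $\rho$. So for $\Re z>a$, with $a$ large, the error
vanishes almost surely on the tree. On the graphs the error, capped at a constant, is bounded by a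
function of the ball, so local convergence transfers the estimate to vertex averages
(`tendsto_average_ball`). This settles $\Re z>a$ (`tendsto_monomerDensity_of_large`).

For small $\Re z$ no such estimate is available, and a Vitali argument replaces it: holomorphic
functions bounded by a multiple of $|z|/\Re z$ that converge for $\Re z>a$ converge locally
uniformly on the whole half-plane. It serves both for the limit on the tree and for the densities.
Finally $zZ'/Z$ sums the monomer weights, so the density is $z$ times the derivative of the pressure
per particle, and locally uniform convergence passes to all derivatives. -/

/-! ### Bounded families of holomorphic functions -/

/-- Pointwise convergence to zero of a bounded family near the centre of a disc forces all
derivatives at the centre to converge to zero. -/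
theorem tendsto_iteratedDeriv_zero {ι : Type*} {l : Filter ι} [l.IsCountablyGenerated]
    {f : ι → ℂ → ℂ} {c : ℂ} {δ M : ℝ} (hδ : 0 < δ)
    (hf : ∀ i, DifferentiableOn ℂ (f i) (Metric.ball c δ))
    (hM : ∀ i, ∀ z ∈ Metric.ball c δ, ‖f i z‖ ≤ M)
    (h0 : ∀ z ∈ Metric.ball c δ, Tendsto (fun i => f i z) l (𝓝 0)) (k : ℕ) :
    Tendsto (fun i => iteratedDeriv k (f i) c) l (𝓝 0) := by
  have hr : 0 < δ / 2 := by positivity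
  have hsub : Metric.closedBall c (δ / 2) ⊆ Metric.ball c δ :=
    Metric.closedBall_subset_ball (by linarith)
  have hsph : ∀ θ, circleMap c (δ / 2) θ ∈ Metric.ball c δ := fun θ =>
    hsub (circleMap_mem_closedBall c hr.le θ)
  have hne : ∀ θ, circleMap c (δ / 2) θ - c ≠ 0 := fun θ =>
    sub_ne_zero.2 (circleMap_ne_center hr.ne')
  -- Cauchy's formula on a circle inside the disc turns the claim into dominated convergence of
  -- integrals with a constant majorant.
  have hform : ∀ i, iteratedDeriv k (f i) c = (2 * Real.pi * Complex.I / k.factorial)⁻¹ •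
      ∮ z in C(c, δ / 2), (1 / (z - c) ^ (k + 1)) • f i z := by
    intro i
    have hd : DiffContOnCl ℂ (f i) (Metric.ball c (δ / 2)) :=
      DifferentiableOn.diffContOnCl_ball (hf i) hsub
    have := hd.circleIntegral_one_div_sub_center_pow_smul hr k
    rw [this, inv_smul_smul₀]
    simp [Nat.factorial_ne_zero]
  simp_rw [hform]
  suffices h : Tendsto (fun i => ∮ z in C(c, δ / 2), (1 / (z - c) ^ (k + 1)) • f i z) l (𝓝 0) by
    simpa using h.const_smul ((2 * Real.pi * Complex.I / k.factorial)⁻¹ : ℂ)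
  unfold circleIntegral
  have hint : (0 : ℂ) = ∫ _ in (0 : ℝ)..2 * Real.pi, (0 : ℂ) := by simp
  rw [hint]
  refine intervalIntegral.tendsto_integral_filter_of_dominated_convergence
    (fun _ => (δ / 2) * ((δ / 2)⁻¹ ^ (k + 1) * M)) ?_ ?_ ?_ ?_
  · refine Eventually.of_forall fun i => Continuous.aestronglyMeasurable ?_
    have hfc : Continuous fun θ => f i (circleMap c (δ / 2) θ) :=
      (hf i).continuousOn.comp_continuous (continuous_circleMap c _) hsph
    simp only [deriv_circleMap]
    refine Continuous.smul ((continuous_circleMap 0 _).mul continuous_const) (Continuous.fun_smul ?_ hfc)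
    exact continuous_const.div (by fun_prop) fun θ => pow_ne_zero _ (hne θ)
  · refine Eventually.of_forall fun i => Eventually.of_forall fun θ _ => ?_
    have h1 : ‖circleMap 0 (δ / 2) θ‖ = δ / 2 := by simp [abs_of_pos hr]
    have h2 : ‖circleMap c (δ / 2) θ - c‖ = δ / 2 := by
      rw [circleMap_sub_center, h1]
    simp only [deriv_circleMap, norm_smul, norm_mul, Complex.norm_I, mul_one, h1, one_div, norm_inv,
      norm_pow, h2, inv_pow]
    gcongr
    exact hM i _ (hsph θ)
  · exact intervalIntegrable_const
  · refine Eventually.of_forall fun θ _ => ?_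
    have := ((h0 _ (hsph θ)).const_smul (1 / (circleMap c (δ / 2) θ - c) ^ (k + 1))).const_smul
      (deriv (circleMap c (δ / 2)) θ)
    simpa using this

/-- A bounded family of holomorphic functions on a disc that converges to zero pointwise near the
centre converges to zero uniformly on smaller concentric discs. -/
theorem tendstoUniformlyOn_zero_of_ball {ι : Type*} {l : Filter ι} [l.IsCountablyGenerated]
    {f : ι → ℂ → ℂ} {c : ℂ} {δ r s M : ℝ} (hδ : 0 < δ) (hr : 0 < r) (hrs : r < s)
    (hf : ∀ i, DifferentiableOn ℂ (f i) (Metric.ball c s))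
    (hM : ∀ i, ∀ z ∈ Metric.ball c s, ‖f i z‖ ≤ M)
    (h0 : ∀ z ∈ Metric.ball c δ, Tendsto (fun i => f i z) l (𝓝 0)) :
    TendstoUniformlyOn f 0 l (Metric.closedBall c r) := by
  -- Cauchy's estimates on the circle of radius `t > r` bound the Taylor terms on the disc of radius
  -- `r` by `M * (r / t) ^ k`, a summable majorant independent of `i`. Termwise convergence then
  -- gives convergence of the sum of norms.
  obtain ⟨t, hrt, hts⟩ := exists_between hrs
  have ht : 0 < t := hr.trans hrt
  have hs : 0 < s := ht.trans hts
  have hcoef : ∀ k, Tendsto (fun i => iteratedDeriv k (f i) c) l (𝓝 0) := by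
    have h1 : Metric.ball c (min δ s) ⊆ Metric.ball c s := Metric.ball_subset_ball (min_le_right _ _)
    have h2 : Metric.ball c (min δ s) ⊆ Metric.ball c δ := Metric.ball_subset_ball (min_le_left _ _)
    exact tendsto_iteratedDeriv_zero (lt_min hδ hs) (fun i => (hf i).mono h1)
      (fun i z hz => hM i z (h1 hz)) (fun z hz => h0 z (h2 hz))
  have hsub : Metric.closedBall c t ⊆ Metric.ball c s := Metric.closedBall_subset_ball hts
  have hbd : ∀ i k, ‖iteratedDeriv k (f i) c‖ ≤ k.factorial * M / t ^ k := fun i k =>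
    Complex.norm_iteratedDeriv_le_of_forall_mem_sphere_norm_le k ht
      (DifferentiableOn.diffContOnCl_ball (hf i) hsub)
      fun z hz => hM i z (hsub (Metric.sphere_subset_closedBall hz))
  have hterm : ∀ i k, (k.factorial : ℝ)⁻¹ * ‖iteratedDeriv k (f i) c‖ * r ^ k
      ≤ M * (r / t) ^ k := by
    intro i k
    have hk : (0 : ℝ) < k.factorial := by exact_mod_cast k.factorial_pos
    calc (k.factorial : ℝ)⁻¹ * ‖iteratedDeriv k (f i) c‖ * r ^ k
        ≤ (k.factorial : ℝ)⁻¹ * (k.factorial * M / t ^ k) * r ^ k := by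
          gcongr
          exact hbd i k
      _ = M * (r / t) ^ k := by
          rw [div_pow]
          field_simp
  have hgeom : Summable fun k : ℕ => M * (r / t) ^ k :=
    (summable_geometric_of_lt_one (by positivity) ((div_lt_one ht).2 hrt)).mul_left M
  have hsum : ∀ i, Summable fun k : ℕ =>
      (k.factorial : ℝ)⁻¹ * ‖iteratedDeriv k (f i) c‖ * r ^ k := fun i =>
    Summable.of_nonneg_of_le (fun k => by positivity) (hterm i) hgeom
  have hlim : Tendsto (fun i => ∑' k : ℕ,
      (k.factorial : ℝ)⁻¹ * ‖iteratedDeriv k (f i) c‖ * r ^ k) l (𝓝 0) := by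
    have := tendsto_tsum_of_dominated_convergence (𝓕 := l)
      (f := fun i (k : ℕ) => (k.factorial : ℝ)⁻¹ * ‖iteratedDeriv k (f i) c‖ * r ^ k)
      (g := fun _ => (0 : ℝ)) hgeom (fun k => by
        simpa using ((hcoef k).norm.const_mul (k.factorial : ℝ)⁻¹).mul_const (r ^ k))
      (Eventually.of_forall fun i k => by
        rw [Real.norm_of_nonneg (by positivity)]
        exact hterm i k)
    simpa using this
  rw [Metric.tendstoUniformlyOn_iff]
  intro ε hε
  filter_upwards [hlim.eventually_lt_const hε] with i hi z hz
  rw [Pi.zero_apply, dist_zero_left]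
  refine lt_of_le_of_lt ?_ hi
  have hz' : ‖z - c‖ ≤ r := by rwa [Metric.mem_closedBall, dist_eq_norm] at hz
  have hb : z ∈ Metric.ball c s := Metric.closedBall_subset_ball hrs hz
  rw [← Complex.taylorSeries_eq_on_ball' hb (hf i)]
  refine tsum_of_norm_bounded (hsum i).hasSum fun k => ?_
  rw [norm_mul, norm_mul, norm_inv, norm_pow, Complex.norm_natCast]
  gcongr

theorem isOpen_rightHalfPlane : IsOpen rightHalfPlane :=
  isOpen_lt continuous_const Complex.continuous_re

/-- A family of holomorphic functions on the right half-plane that is bounded by a multiple of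
`‖z‖ / re z` and tends to zero at every point with a large real part tends to zero locally
uniformly. -/
theorem tendstoLocallyUniformlyOn_zero {ι : Type*} {l : Filter ι} [l.IsCountablyGenerated]
    {f : ι → ℂ → ℂ} {a K : ℝ} (hK : 0 ≤ K)
    (hf : ∀ i, DifferentiableOn ℂ (f i) rightHalfPlane)
    (hM : ∀ i, ∀ z ∈ rightHalfPlane, ‖f i z‖ ≤ K * (‖z‖ / z.re))
    (h0 : ∀ z : ℂ, a < z.re → Tendsto (fun i => f i z) l (𝓝 0)) :
    TendstoLocallyUniformlyOn f 0 l rightHalfPlane := by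
  have key : ∀ z ∈ rightHalfPlane, ∃ u ∈ 𝓝 z, TendstoUniformlyOn f 0 l u := by
    intro z hz
    have hz : 0 < z.re := hz
    -- For real $c>0$, $|z-c|<c$ means $|z|^2<2c\,\Re z$. So a large `c` puts `z` in a disc tangent
    -- to the imaginary axis from the right, and `c > a` puts its centre where convergence is known.
    obtain ⟨c, hc⟩ := exists_gt (max (max a 0) (‖z‖ ^ 2 / (2 * z.re)))
    have hca : a < c := ((le_max_left a 0).trans (le_max_left _ _)).trans_lt hc
    have hc0 : 0 < c := ((le_max_right a 0).trans (le_max_left _ _)).trans_lt hc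
    have hzc : ‖z‖ ^ 2 < 2 * z.re * c := by
      have := (le_max_right (max a 0) (‖z‖ ^ 2 / (2 * z.re))).trans_lt hc
      rwa [div_lt_iff₀ (by positivity), mul_comm] at this
    have hd : dist z c < c := by
      rw [dist_eq_norm]
      refine lt_of_pow_lt_pow_left₀ 2 hc0.le ?_
      rw [← Complex.normSq_eq_norm_sq] at hzc ⊢
      rw [Complex.normSq_apply] at hzc ⊢
      simp only [Complex.sub_re, Complex.ofReal_re, Complex.sub_im, Complex.ofReal_im]
      nlinarith
    obtain ⟨r, hr1, hr2⟩ := exists_between hd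
    obtain ⟨s, hs1, hs2⟩ := exists_between hr2
    have hr0 : 0 < r := dist_nonneg.trans_lt hr1
    have hre : ∀ R : ℝ, ∀ w ∈ Metric.ball (c : ℂ) R, c - R < w.re := by
      intro R w hw
      rw [Metric.mem_ball, dist_eq_norm] at hw
      have := (Complex.abs_re_le_norm (w - c)).trans_lt hw
      rw [Complex.sub_re, Complex.ofReal_re, abs_lt] at this
      linarith [this.1]
    have hsub : Metric.ball (c : ℂ) s ⊆ rightHalfPlane := fun w hw => by
      have := hre s w hw
      change 0 < w.re
      linarith
    refine ⟨Metric.closedBall c r, Metric.closedBall_mem_nhds_of_mem (by simpa using hr1), ?_⟩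
    -- The disc of radius `c - a` about `c` lies in $\Re w>a$; on the disc of radius `s < c`,
    -- $|w|\le c+s$ and $\Re w>c-s$, which gives a uniform bound.
    refine tendstoUniformlyOn_zero_of_ball (δ := c - a) (s := s)
      (M := K * ((c + s) / (c - s))) (by linarith) hr0 hs1
      (fun i => (hf i).mono hsub) ?_ ?_
    · intro i w hw
      refine (hM i w (hsub hw)).trans ?_
      have h1 := hre s w hw
      have h2 : ‖w‖ ≤ c + s := by
        have h3 : ‖w - c‖ < s := by rwa [Metric.mem_ball, dist_eq_norm] at hw
        have h4 := norm_add_le (c : ℂ) (w - c)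
        rw [add_sub_cancel, Complex.norm_real, Real.norm_of_nonneg hc0.le] at h4
        linarith
      have h5 : 0 < c - s := by linarith
      have h6 : 0 ≤ c + s := (norm_nonneg w).trans h2
      gcongr
    · intro w hw
      exact h0 w (by have := hre _ w hw; linarith)
  intro u hu z hz
  obtain ⟨t, ht, h⟩ := key z hz
  exact ⟨t, mem_nhdsWithin_of_mem_nhds ht, h u hu⟩

/-- Vitali's theorem on the right half-plane: a sequence of holomorphic functions, bounded by
a multiple of `‖z‖ / re z`, that converges at every point with a large real part converges locally
uniformly. -/
theorem exists_tendstoLocallyUniformlyOn {f : ℕ → ℂ → ℂ} {a K : ℝ} (hK : 0 ≤ K)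
    (hf : ∀ n, DifferentiableOn ℂ (f n) rightHalfPlane)
    (hM : ∀ n, ∀ z ∈ rightHalfPlane, ‖f n z‖ ≤ K * (‖z‖ / z.re))
    (h0 : ∀ z : ℂ, a < z.re → CauchySeq fun n => f n z) :
    ∃ F : ℂ → ℂ, TendstoLocallyUniformlyOn f F atTop rightHalfPlane := by
  -- No limit function is known yet, so the case of limit zero is applied to differences indexed by
  -- pairs; this yields a uniform Cauchy property.
  have hdiff : TendstoLocallyUniformlyOn (fun (p : ℕ × ℕ) z => f p.1 z - f p.2 z) 0
      (atTop ×ˢ atTop) rightHalfPlane := by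
    refine tendstoLocallyUniformlyOn_zero (a := a) (K := 2 * K) (by positivity)
      (fun p => (hf p.1).sub (hf p.2)) ?_ ?_
    · intro p z hz
      refine (norm_sub_le _ _).trans ?_
      linarith [hM p.1 z hz, hM p.2 z hz]
    · intro z hz
      have := cauchySeq_iff_tendsto.1 (h0 z hz)
      rw [← prod_atTop_atTop_eq, uniformity_eq_comap_nhds_zero ℂ, tendsto_comap_iff] at this
      simpa [Function.comp_def] using this.neg
  have hpt : ∀ z ∈ rightHalfPlane, ∃ y, Tendsto (fun n => f n z) atTop (𝓝 y) := by
    intro z hz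
    refine cauchySeq_tendsto_of_complete (cauchySeq_iff_tendsto.2 ?_)
    rw [← prod_atTop_atTop_eq, uniformity_eq_comap_nhds_zero ℂ, tendsto_comap_iff]
    simpa [Function.comp_def] using (hdiff.tendsto_at hz).neg
  choose! F hF using hpt
  refine ⟨F, ?_⟩
  rw [tendstoLocallyUniformlyOn_iff_forall_isCompact isOpen_rightHalfPlane] at hdiff ⊢
  intro C hC hCc
  refine UniformCauchySeqOn.tendstoUniformlyOn_of_tendsto ?_ fun z hz => hF z (hC hz)
  have h := hdiff C hC hCc
  rw [Metric.tendstoUniformlyOn_iff] at h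
  intro u hu
  obtain ⟨ε, hε, hu⟩ := Metric.mem_uniformity_dist.1 hu
  filter_upwards [h ε hε] with p hp z hz
  refine hu ?_
  have := hp z hz
  rwa [Pi.zero_apply, dist_zero_left, ← dist_eq_norm] at this

/-- Iterated derivatives of a locally uniformly convergent sequence of holomorphic functions. -/
theorem tendstoLocallyUniformlyOn_iteratedDeriv {f : ℕ → ℂ → ℂ} {F : ℂ → ℂ} {U : Set ℂ}
    (hU : IsOpen U) (hf : ∀ n, DifferentiableOn ℂ (f n) U)
    (h : TendstoLocallyUniformlyOn f F atTop U) (k : ℕ) :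
    TendstoLocallyUniformlyOn (fun n => iteratedDeriv k (f n)) (iteratedDeriv k F) atTop U := by
  induction k generalizing f F with
  | zero => simpa [iteratedDeriv_zero] using h
  | succ k ih =>
    simp only [iteratedDeriv_succ']
    refine ih (fun n => (hf n).deriv hU) ?_
    exact h.deriv (Eventually.of_forall hf) hU

/-! ### Recursion over self-avoiding paths -/

section PathRec

variable {V W M : Type*} [AddCommMonoid M]

open Classical in
/-- The recursion over self-avoiding paths in `S` that start at `o`, stopped after `n` steps: the
value at a vertex is `φ` of the sum of the values at its neighbours, in the graph without the
vertex; the value at the end of a path of length `n` is `b`. -/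
noncomputable def pathRec (φ : M → M) (b : M) (G : SimpleGraph V) : ℕ → Finset V → V → M
  | 0, _, _ => b
  | n + 1, S, o => φ (∑ v ∈ (S.erase o).filter (G.Adj o), pathRec φ b G n (S.erase o) v)

theorem pathRec_zero (φ : M → M) (b : M) (G : SimpleGraph V) (S : Finset V) (o : V) :
    pathRec φ b G 0 S o = b := rfl

theorem pathRec_succ (φ : M → M) (b : M) (G : SimpleGraph V) [DecidableEq V] [DecidableRel G.Adj]
    (n : ℕ) (S : Finset V) (o : V) :
    pathRec φ b G (n + 1) S o =
      φ (∑ v ∈ (S.erase o).filter (G.Adj o), pathRec φ b G n (S.erase o) v) := by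
  rw [pathRec]
  congr!

/-- An embedding preserves and reflects adjacency, and the recursion never leaves the image of `S`.
This covers both induced balls and isomorphisms. -/
theorem pathRec_map (φ : M → M) (b : M) {G : SimpleGraph V} {H : SimpleGraph W} (e : G ↪g H)
    (n : ℕ) (S : Finset V) (o : V) :
    pathRec φ b H n (S.map e.toEmbedding) (e o) = pathRec φ b G n S o := by
  classical
  induction n generalizing S o with
  | zero => rfl
  | succ n ih =>
    have h1 : (S.map e.toEmbedding).erase (e o) = (S.erase o).map e.toEmbedding := by
      simp [Finset.map_erase]
    have h2 : ((S.erase o).map e.toEmbedding).filter (H.Adj (e o)) =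
        ((S.erase o).filter (G.Adj o)).map e.toEmbedding := by
      rw [Finset.filter_map]
      congr 1
      exact Finset.filter_congr fun v _ => e.map_adj_iff
    rw [pathRec_succ, pathRec_succ, h1, h2, Finset.sum_map]
    exact congrArg φ (Finset.sum_congr rfl fun v _ => ih _ v)

/-- The recursion of depth `n` only sees the ball of radius `n`. -/
theorem pathRec_inter [DecidableEq V] (φ : M → M) (b : M) (G : SimpleGraph V) {A : Finset V}
    (n : ℕ) (S : Finset V) (o : V) (hA : ∀ u, G.edist o u ≤ n → u ∈ A) :
    pathRec φ b G n (S ∩ A) o = pathRec φ b G n S o := by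
  classical
  induction n generalizing S o with
  | zero => rfl
  | succ n ih =>
    have h1 : (S ∩ A).erase o = S.erase o ∩ A := by
      rw [Finset.erase_inter]
    have hadj : ∀ v u, G.Adj o v → G.edist v u ≤ n → u ∈ A := fun v u hv hu => hA u <| by
      refine (SimpleGraph.edist_triangle (v := v)).trans ?_
      rw [SimpleGraph.edist_eq_one_iff_adj.2 hv, add_comm, Nat.cast_succ]
      gcongr
    have h2 : (S.erase o ∩ A).filter (G.Adj o) = (S.erase o).filter (G.Adj o) := by
      ext v
      simp only [Finset.mem_filter, Finset.mem_inter]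
      refine ⟨fun h => ⟨h.1.1, h.2⟩, fun h => ⟨⟨h.1, hadj v v h.2 (by simp)⟩, h.2⟩⟩
    rw [pathRec_succ, pathRec_succ, h1, h2]
    refine congrArg φ (Finset.sum_congr rfl fun v hv => ih _ v fun u hu => ?_)
    exact hadj v u (Finset.mem_filter.1 hv).2 hu

/-- The recursion of depth `r` agrees on a graph and on the ball of radius `r`. -/
theorem pathRec_ball [Fintype V] (φ : M → M) (b : M) (G : SimpleGraph V) (v : V) (r : ℕ)
    [Fintype (ballSet G v r)] :
    pathRec φ b (ball G v r) r Finset.univ (ballRoot G v r) = pathRec φ b G r Finset.univ v := by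
  classical
  have h := pathRec_inter φ b G (A := Finset.univ.map
    (SimpleGraph.Embedding.induce (G := G) (ballSet G v r)).toEmbedding) r Finset.univ v
    fun u hu => Finset.mem_map.2 ⟨⟨u, hu⟩, Finset.mem_univ _, rfl⟩
  rw [Finset.univ_inter] at h
  exact (pathRec_map φ b (SimpleGraph.Embedding.induce (G := G) (ballSet G v r)) r
    Finset.univ (ballRoot G v r)).symm.trans h

theorem pathRec_of_rootedIso [Fintype V] [Fintype W] (φ : M → M) (b : M) {G : SimpleGraph V}
    {H : SimpleGraph W} {o : V} {p : W} (h : RootedIso G o H p) (r : ℕ) :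
    pathRec φ b G r Finset.univ o = pathRec φ b H r Finset.univ p := by
  obtain ⟨e, rfl⟩ := h
  have h1 : Finset.univ.map e.toRelEmbedding.toEmbedding = Finset.univ :=
    Finset.map_univ_equiv e.toEquiv
  have h2 := pathRec_map φ b e.toRelEmbedding r Finset.univ o
  rw [h1] at h2
  exact h2.symm

end PathRec

/-! ### Monomer weights through the path recursion -/

section Weights

variable {V : Type*}

/-- The recursion for the ratios `Z_{S \ o} / Z_S`. -/
noncomputable def monomerRec (z : ℂ) (G : SimpleGraph V) (n : ℕ) (S : Finset V) (o : V) : ℂ :=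
  pathRec (fun s => (z + s)⁻¹) z⁻¹ G n S o

/-- The number of self-avoiding paths of length `n` in `S` that start at `o`. -/
noncomputable def pathCount (G : SimpleGraph V) (n : ℕ) (S : Finset V) (o : V) : ℕ :=
  pathRec id 1 G n S o

theorem inv_re_pos {w : ℂ} (h : 0 < w.re) : 0 < (w⁻¹).re := by
  rw [Complex.inv_re]
  exact div_pos h (Complex.normSq_pos.2 fun h0 => by simp [h0] at h)

/-- The open right half-plane is closed under addition and inversion. This is what replaces
positivity of the weights at complex activity. -/
theorem monomerRec_re_pos {z : ℂ} (hz : 0 < z.re) (G : SimpleGraph V) (n : ℕ) (S : Finset V)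
    (o : V) : 0 < (monomerRec z G n S o).re := by
  induction n generalizing S o with
  | zero => exact inv_re_pos hz
  | succ n ih =>
    classical
    unfold monomerRec at ih ⊢
    rw [pathRec_succ]
    refine inv_re_pos ?_
    rw [Complex.add_re, Complex.re_sum]
    exact add_pos_of_pos_of_nonneg hz (Finset.sum_nonneg fun v _ => (ih _ v).le)

theorem norm_inv_le_of_re {z w : ℂ} (hz : 0 < z.re) (h : z.re ≤ w.re) : ‖w⁻¹‖ ≤ z.re⁻¹ := by
  rw [norm_inv]
  exact inv_anti₀ hz (h.trans (Complex.re_le_norm w))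

open Classical in
theorem re_le_re_add_sum {z : ℂ} (hz : 0 < z.re) (G : SimpleGraph V) (n : ℕ) (S T : Finset V) :
    z.re ≤ (z + ∑ v ∈ T, monomerRec z G n S v).re := by
  rw [Complex.add_re, Complex.re_sum]
  exact le_add_of_nonneg_right (Finset.sum_nonneg fun v _ => (monomerRec_re_pos hz G n S v).le)

theorem monomerRec_succ (z : ℂ) (G : SimpleGraph V) [DecidableEq V] [DecidableRel G.Adj] (n : ℕ)
    (S : Finset V) (o : V) :
    monomerRec z G (n + 1) S o =
      (z + ∑ v ∈ (S.erase o).filter (G.Adj o), monomerRec z G n (S.erase o) v)⁻¹ := by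
  unfold monomerRec
  rw [pathRec_succ]

theorem pathCount_succ (G : SimpleGraph V) [DecidableEq V] [DecidableRel G.Adj] (n : ℕ)
    (S : Finset V) (o : V) :
    pathCount G (n + 1) S o =
      ∑ v ∈ (S.erase o).filter (G.Adj o), pathCount G n (S.erase o) v := by
  unfold pathCount
  rw [pathRec_succ]
  simp only [id]

theorem norm_monomerRec_le {z : ℂ} (hz : 0 < z.re) (G : SimpleGraph V) (n : ℕ) (S : Finset V)
    (o : V) : ‖monomerRec z G n S o‖ ≤ z.re⁻¹ := by
  classical
  cases n with
  | zero => exact norm_inv_le_of_re hz le_rfl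
  | succ n =>
    rw [monomerRec_succ]
    exact norm_inv_le_of_re hz (re_le_re_add_sum hz G n _ _)

/-- The Lipschitz constant of inversion on the half-plane where the denominators live; it is the
price of one step of the recursion. -/
theorem norm_inv_sub_inv_le {z u w : ℂ} (hz : 0 < z.re) (hu : z.re ≤ u.re) (hw : z.re ≤ w.re) :
    ‖u⁻¹ - w⁻¹‖ ≤ (z.re ^ 2)⁻¹ * ‖u - w‖ := by
  have hu0 : u ≠ 0 := fun h => by rw [h, Complex.zero_re] at hu; linarith
  have hw0 : w ≠ 0 := fun h => by rw [h, Complex.zero_re] at hw; linarith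
  have : u⁻¹ - w⁻¹ = u⁻¹ * w⁻¹ * (w - u) := by field_simp
  rw [this, norm_mul, norm_mul, norm_sub_rev w u, sq, mul_inv]
  gcongr
  · exact norm_inv_le_of_re hz hu
  · exact norm_inv_le_of_re hz hw

/-- Cutting the recursion after `r` steps changes its value by at most a multiple of the number of
paths of length `r`. -/
theorem norm_monomerRec_sub_le {z : ℂ} (hz : 0 < z.re) (G : SimpleGraph V) {r m : ℕ} (hrm : r ≤ m)
    (S : Finset V) (o : V) :
    ‖monomerRec z G m S o - monomerRec z G r S o‖ ≤
      2 * z.re⁻¹ * ((z.re ^ 2)⁻¹ ^ r * pathCount G r S o) := by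
  classical
  induction r generalizing m S o with
  | zero =>
    refine (norm_sub_le _ _).trans ?_
    have h1 := norm_monomerRec_le hz G m S o
    have h2 := norm_monomerRec_le hz G 0 S o
    simp only [pathCount, pathRec_zero, pow_zero, Nat.cast_one, mul_one]
    linarith
  | succ r ih =>
    obtain ⟨m, rfl⟩ : ∃ k, m = k + 1 := ⟨m - 1, by omega⟩
    rw [monomerRec_succ, monomerRec_succ, pathCount_succ]
    -- Each level contributes one factor `(z.re ^ 2)⁻¹` and branches over the admissible neighbours,
    -- so the errors at the ends add up over the paths of length `r`.
    refine (norm_inv_sub_inv_le hz (re_le_re_add_sum hz G _ _ _)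
      (re_le_re_add_sum hz G _ _ _)).trans ?_
    rw [add_sub_add_left_eq_sub, ← Finset.sum_sub_distrib]
    calc (z.re ^ 2)⁻¹ * ‖∑ v ∈ (S.erase o).filter (G.Adj o),
            (monomerRec z G m (S.erase o) v - monomerRec z G r (S.erase o) v)‖
        ≤ (z.re ^ 2)⁻¹ * ∑ v ∈ (S.erase o).filter (G.Adj o),
            2 * z.re⁻¹ * ((z.re ^ 2)⁻¹ ^ r * pathCount G r (S.erase o) v) := by
          gcongr
          exact norm_sum_le_of_le _ fun v _ => ih (by omega) _ v
      _ = _ := by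
          rw [← Finset.mul_sum, ← Finset.mul_sum]
          push_cast
          ring

theorem differentiableOn_monomerRec (G : SimpleGraph V) (n : ℕ) (S : Finset V) (o : V) :
    DifferentiableOn ℂ (fun z => monomerRec z G n S o) rightHalfPlane := by
  classical
  have hne : ∀ {z w : ℂ}, z ∈ rightHalfPlane → z.re ≤ w.re → w ≠ 0 := fun {z w} hz h h0 => by
    rw [h0] at h
    exact absurd (show 0 < z.re from hz) (not_lt.2 h)
  induction n generalizing S o with
  | zero => exact differentiableOn_id.inv fun z hz => hne hz le_rfl
  | succ n ih =>
    simp only [monomerRec_succ]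
    exact (differentiableOn_id.add (DifferentiableOn.fun_sum fun v _ => ih _ v)).inv
      fun z hz => hne hz (re_le_re_add_sum hz G n _ _)

end Weights

/-! ### The partition function of an induced subgraph -/

section Partition

variable {V : Type*} [Fintype V]

open Classical in
/-- Dimeric configurations within the vertex set `S`. -/
noncomputable def matchingsOn (G : SimpleGraph V) (S : Finset V) : Finset (Finset (Sym2 V)) :=
  (dimericConfigs G).filter fun D => ∀ e ∈ D, ∀ v ∈ e, v ∈ S

/-- The partition function of the subgraph induced on `S`. -/
noncomputable def partitionOn (G : SimpleGraph V) (S : Finset V) (z : ℂ) : ℂ :=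
  ∑ D ∈ matchingsOn G S, z ^ (S.card - 2 * D.card)

theorem mem_matchingsOn {G : SimpleGraph V} {S : Finset V} {D : Finset (Sym2 V)} :
    D ∈ matchingsOn G S ↔ (∀ e ∈ D, e ∈ G.edgeSet) ∧
      (∀ e ∈ D, ∀ f ∈ D, e ≠ f → ∀ v, ¬ (v ∈ e ∧ v ∈ f)) ∧ ∀ e ∈ D, ∀ v ∈ e, v ∈ S := by
  simp only [matchingsOn, dimericConfigs, Finset.mem_filter, Finset.mem_univ, true_and, and_assoc]

theorem two_mul_card_le {G : SimpleGraph V} {S : Finset V} {D : Finset (Sym2 V)}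
    (hD : D ∈ matchingsOn G S) : 2 * D.card ≤ S.card := by
  classical
  have h1 := card_monomers_add G D (Finset.mem_filter.1 hD).1
  have h2 : Sᶜ ⊆ monomers D := fun v hv => by
    simp only [monomers, Finset.mem_filter, Finset.mem_univ, true_and]
    exact fun u hu => Finset.mem_compl.1 hv ((mem_matchingsOn.1 hD).2.2 _ hu v (Sym2.mem_mk_right u v))
  have h3 := Finset.card_le_card h2
  have h4 := Finset.card_add_card_compl S
  omega

theorem matchingsOn_erase [DecidableEq V] (G : SimpleGraph V) (S : Finset V) (o : V) :
    matchingsOn G (S.erase o) = (matchingsOn G S).filter fun D => o ∈ monomers D := by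
  classical
  ext D
  simp only [Finset.mem_filter, mem_matchingsOn, monomers, Finset.mem_univ, true_and, and_assoc,
    Finset.mem_erase]
  refine and_congr_right fun _ => and_congr_right fun _ => ⟨fun h => ?_, fun h e he v hv => ?_⟩
  · exact ⟨fun e he v hv => (h e he v hv).2, fun u hu => (h _ hu o (Sym2.mem_mk_right u o)).1 rfl⟩
  · refine ⟨?_, h.1 e he v hv⟩
    rintro rfl
    obtain ⟨u, rfl⟩ := hv
    exact h.2 u (by rwa [Sym2.eq_swap])

theorem sum_monomers_eq [DecidableEq V] (G : SimpleGraph V) {S : Finset V} {o : V} (ho : o ∈ S)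
    (z : ℂ) [DecidablePred fun D : Finset (Sym2 V) => o ∈ monomers D] :
    ∑ D ∈ (matchingsOn G S).filter (fun D => o ∈ monomers D), z ^ (S.card - 2 * D.card) =
      z * partitionOn G (S.erase o) z := by
  rw [partitionOn, matchingsOn_erase, Finset.mul_sum]
  refine Finset.sum_congr (by congr!) fun D hD => ?_
  have h1 : D ∈ matchingsOn G (S.erase o) := by rw [matchingsOn_erase]; convert hD
  have h2 := two_mul_card_le h1
  have h3 := Finset.card_erase_add_one ho
  rw [← pow_succ']
  congr 1
  omega

/-- Removing the dimer at `o` is a bijection onto pairs of a neighbour `v` and a configuration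
avoiding `o` and `v`. Two vertices and one dimer disappear, so the exponent is unchanged. -/
theorem sum_not_monomers_eq [DecidableEq V] (G : SimpleGraph V) [DecidableRel G.Adj]
    {S : Finset V} {o : V} (ho : o ∈ S)
    (z : ℂ) [DecidablePred fun D : Finset (Sym2 V) => o ∈ monomers D] :
    ∑ D ∈ (matchingsOn G S).filter (fun D => o ∉ monomers D), z ^ (S.card - 2 * D.card) =
      ∑ v ∈ (S.erase o).filter (G.Adj o), partitionOn G ((S.erase o).erase v) z := by
  simp only [partitionOn]
  rw [Finset.sum_sigma']
  symm
  have hfree : ∀ {v : V} {D : Finset (Sym2 V)}, D ∈ matchingsOn G ((S.erase o).erase v) →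
      ∀ e ∈ D, o ∉ e ∧ v ∉ e := fun {v D} hD e he =>
    ⟨fun h => by simpa using (mem_matchingsOn.1 hD).2.2 e he o h,
      fun h => by simpa using (mem_matchingsOn.1 hD).2.2 e he v h⟩
  refine Finset.sum_bij (fun p _ => insert s(o, p.1) p.2) ?_ ?_ ?_ ?_
  · rintro ⟨v, D⟩ h
    simp only [Finset.mem_sigma, Finset.mem_filter, Finset.mem_erase] at h
    obtain ⟨⟨⟨hvo, hvS⟩, hadj⟩, hD⟩ := h
    have hf := hfree hD
    obtain ⟨h1, h2, h3⟩ := mem_matchingsOn.1 hD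
    rw [Finset.mem_filter, mem_matchingsOn]
    refine ⟨⟨?_, ?_, ?_⟩, ?_⟩
    · simpa [hadj] using h1
    · intro e he f hff hef w hw
      rw [Finset.mem_insert] at he hff
      rcases he with rfl | he <;> rcases hff with rfl | hff
      · exact hef rfl
      · rcases Sym2.mem_iff.1 hw.1 with rfl | rfl
        · exact (hf f hff).1 hw.2
        · exact (hf f hff).2 hw.2
      · rcases Sym2.mem_iff.1 hw.2 with rfl | rfl
        · exact (hf e he).1 hw.1
        · exact (hf e he).2 hw.1
      · exact h2 e he f hff hef w hw
    · intro e he w hw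
      rw [Finset.mem_insert] at he
      rcases he with rfl | he
      · rcases Sym2.mem_iff.1 hw with rfl | rfl
        · exact ho
        · exact hvS
      · exact Finset.mem_of_mem_erase (Finset.mem_of_mem_erase (h3 e he w hw))
    · simp only [monomers, Finset.mem_filter, Finset.mem_univ, true_and, not_forall, not_not]
      exact ⟨v, by rw [Sym2.eq_swap]; exact Finset.mem_insert_self _ _⟩
  · rintro ⟨v, D⟩ h ⟨v', D'⟩ h' heq
    simp only [Finset.mem_sigma, Finset.mem_filter, Finset.mem_erase] at h h' heq
    have hf := hfree h.2
    have hf' := hfree h'.2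
    have hv : v = v' := by
      have : s(o, v) ∈ insert s(o, v') D' := heq ▸ Finset.mem_insert_self _ _
      rcases Finset.mem_insert.1 this with h0 | h0
      · exact Sym2.congr_right.1 h0
      · exact absurd (Sym2.mem_mk_left o v) (hf' _ h0).1
    subst hv
    have h1 : s(o, v) ∉ D := fun h0 => (hf _ h0).1 (Sym2.mem_mk_left o v)
    have h2 : s(o, v) ∉ D' := fun h0 => (hf' _ h0).1 (Sym2.mem_mk_left o v)
    have : D = D' := by rw [← Finset.erase_insert h1, heq, Finset.erase_insert h2]
    rw [this]
  · intro D hD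
    rw [Finset.mem_filter] at hD
    obtain ⟨hD, hno⟩ := hD
    obtain ⟨h1, h2, h3⟩ := mem_matchingsOn.1 hD
    simp only [monomers, Finset.mem_filter, Finset.mem_univ, true_and, not_forall, not_not] at hno
    obtain ⟨v, hv⟩ := hno
    rw [Sym2.eq_swap] at hv
    have hadj : G.Adj o v := h1 _ hv
    refine ⟨⟨v, D.erase s(o, v)⟩, ?_, Finset.insert_erase hv⟩
    simp only [Finset.mem_sigma, Finset.mem_filter, Finset.mem_erase]
    refine ⟨⟨⟨hadj.ne', h3 _ hv v (Sym2.mem_mk_right o v)⟩, hadj⟩, mem_matchingsOn.2 ⟨?_, ?_, ?_⟩⟩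
    · exact fun e he => h1 e (Finset.mem_of_mem_erase he)
    · exact fun e he f hf => h2 e (Finset.mem_of_mem_erase he) f (Finset.mem_of_mem_erase hf)
    · intro e he w hw
      rw [Finset.mem_erase] at he
      refine Finset.mem_erase.2 ⟨?_, Finset.mem_erase.2 ⟨?_, h3 e he.2 w hw⟩⟩
      · rintro rfl
        exact h2 e he.2 _ hv he.1 _ ⟨hw, Sym2.mem_mk_right o _⟩
      · rintro rfl
        exact h2 e he.2 _ hv he.1 _ ⟨hw, Sym2.mem_mk_left _ v⟩
  · rintro ⟨v, D⟩ h
    simp only [Finset.mem_sigma, Finset.mem_filter] at h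
    have h1 : s(o, v) ∉ D := fun h0 => (hfree h.2 _ h0).1 (Sym2.mem_mk_left o v)
    have h2 := Finset.card_erase_add_one ho
    have h3 := Finset.card_erase_add_one h.1.1
    change z ^ (((S.erase o).erase v).card - 2 * D.card) = z ^ (S.card - 2 * (insert s(o, v) D).card)
    rw [Finset.card_insert_of_notMem h1]
    congr 1
    omega

/-- The Heilmann-Lieb recursion. -/
theorem partitionOn_eq [DecidableEq V] (G : SimpleGraph V) [DecidableRel G.Adj] {S : Finset V}
    {o : V} (ho : o ∈ S) (z : ℂ) :
    partitionOn G S z = z * partitionOn G (S.erase o) z +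
      ∑ v ∈ (S.erase o).filter (G.Adj o), partitionOn G ((S.erase o).erase v) z := by
  classical
  rw [← sum_monomers_eq G ho, ← sum_not_monomers_eq G ho, Finset.sum_filter_add_sum_filter_not,
    partitionOn]

theorem partitionOn_empty (G : SimpleGraph V) (z : ℂ) : partitionOn G ∅ z = 1 := by
  have : matchingsOn G ∅ = {∅} := by
    ext D
    rw [Finset.mem_singleton, mem_matchingsOn]
    refine ⟨fun h => Finset.eq_empty_of_forall_notMem fun e he => ?_, ?_⟩
    · induction e with
      | _ x y => simpa using h.2.2 _ he x (Sym2.mem_mk_left x y)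
    · rintro rfl
      simp
  rw [partitionOn, this]
  simp

theorem partitionOn_univ (G : SimpleGraph V) (z : ℂ) :
    partitionOn G Finset.univ z = partitionFunction G z := by
  have : matchingsOn G Finset.univ = dimericConfigs G := by
    simp [matchingsOn]
  rw [partitionOn, partitionFunction, this, Finset.card_univ]

/-- The two claims need each other: the identity for smaller sets writes `partitionOn G S z` as
`partitionOn G (S.erase o) z` times a factor of positive real part, and nonvanishing lets one
divide. -/
theorem partitionOn_ne_zero_and_monomerRec [DecidableEq V] (G : SimpleGraph V) {z : ℂ}
    (hz : 0 < z.re) (n : ℕ) (S : Finset V) (hn : S.card ≤ n) :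
    partitionOn G S z ≠ 0 ∧
      ∀ o ∈ S, monomerRec z G n S o = partitionOn G (S.erase o) z / partitionOn G S z := by
  classical
  induction n generalizing S with
  | zero =>
    obtain rfl := Finset.card_eq_zero.1 (Nat.le_zero.1 hn)
    simp [partitionOn_empty]
  | succ n ih =>
    have key : ∀ o ∈ S, partitionOn G (S.erase o) z ≠ 0 ∧ partitionOn G S z =
        partitionOn G (S.erase o) z *
          (z + ∑ v ∈ (S.erase o).filter (G.Adj o), monomerRec z G n (S.erase o) v) := by
      intro o ho
      have hc : (S.erase o).card ≤ n := by
        have := Finset.card_erase_add_one ho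
        omega
      obtain ⟨h1, h2⟩ := ih _ hc
      refine ⟨h1, ?_⟩
      rw [partitionOn_eq G ho, mul_add, Finset.mul_sum, mul_comm z]
      congr 1
      refine Finset.sum_congr rfl fun v hv => ?_
      rw [h2 v (Finset.mem_filter.1 hv).1, mul_div_cancel₀ _ h1]
    have hpos : ∀ o, (z + ∑ v ∈ (S.erase o).filter (G.Adj o),
        monomerRec z G n (S.erase o) v) ≠ 0 := fun o h0 => by
      have := re_le_re_add_sum hz G n (S.erase o) ((S.erase o).filter (G.Adj o))
      rw [h0, Complex.zero_re] at this
      linarith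
    refine ⟨?_, fun o ho => ?_⟩
    · rcases S.eq_empty_or_nonempty with rfl | ⟨o, ho⟩
      · simp [partitionOn_empty]
      · rw [(key o ho).2]
        exact mul_ne_zero (key o ho).1 (hpos o)
    · rw [monomerRec_succ, (key o ho).2]
      have h1 := (key o ho).1
      have h2 := hpos o
      field_simp

theorem partitionOn_ne_zero (G : SimpleGraph V) {z : ℂ} (hz : 0 < z.re) (S : Finset V) :
    partitionOn G S z ≠ 0 := by
  classical
  exact (partitionOn_ne_zero_and_monomerRec G hz _ S le_rfl).1

/-- Any depth `n` beyond the number of vertices is exact. The slack permits comparison with depth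
`r` even when `r` exceeds that number. -/
theorem monomerProb_eq (G : SimpleGraph V) {z : ℂ} (hz : 0 < z.re) (o : V) {n : ℕ}
    (hn : Fintype.card V ≤ n) :
    monomerProb G z o = z * monomerRec z G n Finset.univ o := by
  classical
  rw [(partitionOn_ne_zero_and_monomerRec G hz n Finset.univ (by simpa using hn)).2 o
    (Finset.mem_univ o), ← mul_div_assoc, ← sum_monomers_eq G (Finset.mem_univ o), monomerProb,
    partitionOn_univ, Finset.sum_div, Finset.sum_filter]
  have : matchingsOn G Finset.univ = dimericConfigs G := by
    simp [matchingsOn]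
  rw [this, Finset.card_univ]

end Partition

/-! ### The pressure -/

section Pressure

variable {V : Type*} [Fintype V]

theorem partitionOn_ofReal (G : SimpleGraph V) (S : Finset V) (x : ℝ) :
    partitionOn G S (x : ℂ) = ((∑ D ∈ matchingsOn G S, x ^ (S.card - 2 * D.card) : ℝ) : ℂ) := by
  simp [partitionOn]

theorem partitionFunction_ofReal (G : SimpleGraph V) (x : ℝ) :
    partitionFunction G (x : ℂ) = ((partitionFunction G x : ℝ) : ℂ) := by
  simp [partitionFunction]

/-- Deleting vertices one by one writes `partitionOn G S z` as a product of ratios of positive real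
part. Each has a principal logarithm, real on the positive axis, and these add up. -/
theorem exists_log_partitionOn (G : SimpleGraph V) (n : ℕ) (S : Finset V) (hn : S.card = n) :
    ∃ L : ℂ → ℂ, DifferentiableOn ℂ L rightHalfPlane ∧
      (∀ z ∈ rightHalfPlane, Complex.exp (L z) = partitionOn G S z) ∧
      ∀ x : ℝ, 0 < x → ∃ y : ℝ, L x = y := by
  classical
  induction n generalizing S with
  | zero =>
    obtain rfl := Finset.card_eq_zero.1 hn
    exact ⟨fun _ => 0, differentiableOn_const 0, fun z _ => by simp [partitionOn_empty],
      fun _ _ => ⟨0, by simp⟩⟩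
  | succ n ih =>
    obtain ⟨o, ho⟩ : S.Nonempty := Finset.card_pos.1 (by omega)
    obtain ⟨L, h1, h2, h3⟩ := ih (S.erase o) (by rw [Finset.card_erase_of_mem ho]; omega)
    have hq : ∀ z ∈ rightHalfPlane, (monomerRec z G (n + 1) S o)⁻¹ =
        partitionOn G S z / partitionOn G (S.erase o) z := fun z hz => by
      rw [(partitionOn_ne_zero_and_monomerRec G hz (n + 1) S hn.le).2 o ho, inv_div]
    have hre : ∀ z ∈ rightHalfPlane, 0 < ((monomerRec z G (n + 1) S o)⁻¹).re := fun z hz =>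
      inv_re_pos (monomerRec_re_pos hz G _ S o)
    have hne : ∀ z ∈ rightHalfPlane, (monomerRec z G (n + 1) S o)⁻¹ ≠ 0 := fun z hz h0 => by
      have := hre z hz
      simp [h0] at this
    refine ⟨fun z => L z + Complex.log (monomerRec z G (n + 1) S o)⁻¹, ?_, ?_, ?_⟩
    · refine h1.add (DifferentiableOn.clog ((differentiableOn_monomerRec G _ S o).inv
        fun z hz => ?_) fun z hz => Or.inl (hre z hz))
      exact fun h0 => hne z hz (by rw [h0, inv_zero])
    · intro z hz
      rw [Complex.exp_add, h2 z hz, Complex.exp_log (hne z hz), hq z hz,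
        mul_div_cancel₀ _ (partitionOn_ne_zero G hz _)]
    · intro x hx
      obtain ⟨y, hy⟩ := h3 x hx
      have hx' : (x : ℂ) ∈ rightHalfPlane := hx
      obtain ⟨q, hq'⟩ : ∃ q : ℝ, (monomerRec (x : ℂ) G (n + 1) S o)⁻¹ = q := by
        rw [hq _ hx', partitionOn_ofReal, partitionOn_ofReal, ← Complex.ofReal_div]
        exact ⟨_, rfl⟩
      have h0 := hre _ hx'
      rw [hq', Complex.ofReal_re] at h0
      refine ⟨y + Real.log q, ?_⟩
      change L x + Complex.log (monomerRec x G (n + 1) S o)⁻¹ = _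
      rw [hy, hq', Complex.ofReal_add, Complex.ofReal_log h0.le]

theorem exists_isLogPartition (G : SimpleGraph V) : ∃ L : ℂ → ℂ, IsLogPartition G L := by
  obtain ⟨L, h1, h2, h3⟩ := exists_log_partitionOn G _ Finset.univ rfl
  refine ⟨L, h1, fun z hz => by rw [h2 z hz, partitionOn_univ], fun x hx => ?_⟩
  obtain ⟨y, hy⟩ := h3 x hx
  have h := h2 x hx
  rw [hy, partitionOn_univ, partitionFunction_ofReal, ← Complex.ofReal_exp,
    Complex.ofReal_inj] at h
  rw [hy, ← h, Real.log_exp]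

theorem hasDerivAt_partitionFunction (G : SimpleGraph V) (z : ℂ) :
    HasDerivAt (partitionFunction G) (∑ D ∈ dimericConfigs G,
      ((Fintype.card V - 2 * D.card : ℕ) : ℂ) * z ^ (Fintype.card V - 2 * D.card - 1)) z := by
  unfold partitionFunction
  exact HasDerivAt.fun_sum fun D _ => hasDerivAt_pow _ z

/-- The operator $z\,d/dz$ multiplies each term by its exponent, which is the number of monomers;
exchanging the sums over vertices and configurations does the rest. -/
theorem mul_deriv_partitionFunction (G : SimpleGraph V) {z : ℂ} (hz : 0 < z.re) :
    z * deriv (partitionFunction G) z =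
      (∑ v, monomerProb G z v) * partitionFunction G z := by
  classical
  have hZ : partitionFunction G z ≠ 0 := by
    rw [← partitionOn_univ]
    exact partitionOn_ne_zero G hz _
  rw [(hasDerivAt_partitionFunction G z).deriv, Finset.mul_sum]
  simp only [monomerProb]
  rw [Finset.sum_comm, Finset.sum_mul]
  refine Finset.sum_congr rfl fun D hD => ?_
  have h1 := card_monomers_add G D hD
  have h2 : Fintype.card V - 2 * D.card = (monomers D).card := by omega
  rw [h2, ← Finset.sum_filter, Finset.sum_const, nsmul_eq_mul, Finset.filter_mem_eq_inter,
    Finset.univ_inter, mul_assoc, div_mul_cancel₀ _ hZ]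
  rcases Nat.eq_zero_or_pos (monomers D).card with h0 | h0
  · simp [h0]
  · rw [mul_left_comm, mul_pow_sub_one h0.ne']

theorem monomerDensity_eq (G : SimpleGraph V) {L : ℂ → ℂ} (hL : IsLogPartition G L) {z : ℂ}
    (hz : z ∈ rightHalfPlane) :
    monomerDensity G z = z * deriv (fun w => L w / (Fintype.card V : ℂ)) z := by
  have hZ : partitionFunction G z ≠ 0 := by
    rw [← partitionOn_univ]
    exact partitionOn_ne_zero G hz _
  have hLd : DifferentiableAt ℂ L z := hL.holo.differentiableAt (isOpen_rightHalfPlane.mem_nhds hz)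
  have h1 : deriv (partitionFunction G) z = partitionFunction G z * deriv L z := by
    have h2 : (fun w => Complex.exp (L w)) =ᶠ[𝓝 z] partitionFunction G := by
      filter_upwards [isOpen_rightHalfPlane.mem_nhds hz] with w hw using hL.exp_eq w hw
    rw [← h2.deriv_eq, ← hL.exp_eq z hz]
    exact hLd.hasDerivAt.cexp.deriv
  have h3 := mul_deriv_partitionFunction G hz
  rw [h1, mul_comm (∑ v, _), mul_left_comm] at h3
  rw [monomerDensity, deriv_div_const, ← mul_left_cancel₀ hZ h3, mul_div_assoc]

theorem differentiableOn_monomerProb (G : SimpleGraph V) (o : V) :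
    DifferentiableOn ℂ (fun z => monomerProb G z o) rightHalfPlane :=
  (differentiableOn_id.mul (differentiableOn_monomerRec G _ Finset.univ o)).congr
    fun _ hz => monomerProb_eq G hz o le_rfl

theorem norm_monomerProb_le (G : SimpleGraph V) (o : V) {z : ℂ} (hz : z ∈ rightHalfPlane) :
    ‖monomerProb G z o‖ ≤ ‖z‖ / z.re := by
  rw [monomerProb_eq G hz o le_rfl, norm_mul, div_eq_mul_inv]
  gcongr
  exact norm_monomerRec_le hz G _ _ o

theorem norm_average_le [Nonempty V] {f : V → ℂ} {B : ℝ} (hf : ∀ v, ‖f v‖ ≤ B) :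
    ‖(∑ v, f v) / (Fintype.card V : ℂ)‖ ≤ B := by
  have hc : (0 : ℝ) < Fintype.card V := by exact_mod_cast Fintype.card_pos
  rw [norm_div, Complex.norm_natCast, div_le_iff₀ hc]
  refine (norm_sum_le_of_le _ fun v _ => hf v).trans ?_
  rw [Finset.sum_const, nsmul_eq_mul, mul_comm, Finset.card_univ]

theorem norm_monomerDensity_le [Nonempty V] (G : SimpleGraph V) {z : ℂ}
    (hz : z ∈ rightHalfPlane) : ‖monomerDensity G z‖ ≤ ‖z‖ / z.re :=
  norm_average_le fun v => norm_monomerProb_le G v hz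

theorem differentiableOn_monomerDensity (G : SimpleGraph V) :
    DifferentiableOn ℂ (monomerDensity G) rightHalfPlane :=
  (DifferentiableOn.fun_sum fun v _ => differentiableOn_monomerProb G v).div_const _

end Pressure

/-! ### Recursions on trees -/

section Tree

variable {M : Type*} [AddCommMonoid M]

/-- The recursion over the descendants of a vertex, stopped after `n` generations. -/
def treeRec (φ : M → M) (b : M) (N : List ℕ → ℕ) : ℕ → List ℕ → M
  | 0, _ => b
  | n + 1, w => φ (∑ i ∈ Finset.range (N w), treeRec φ b N n (i :: w))

theorem treeRec_succ (φ : M → M) (b : M) (N : List ℕ → ℕ) (n : ℕ) (w : List ℕ) :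
    treeRec φ b N (n + 1) w = φ (∑ i ∈ Finset.range (N w), treeRec φ b N n (i :: w)) := rfl

theorem treeVertex_ext {N : List ℕ → ℕ} {r : ℕ} {a b : TreeVertex N r} (h : a.1 = b.1) : a = b :=
  Subtype.ext h

/-- On a truncated tree, the recursion over self-avoiding paths runs through the descendants. -/
theorem pathRec_truncTree (φ : M → M) (b : M) {N : List ℕ → ℕ} {R : ℕ} (n : ℕ)
    (S : Finset (TreeVertex N R)) (w : TreeVertex N R)
    (hpar : ∀ p ∈ S, ∀ i, w.1 ≠ i :: p.1) (hdesc : ∀ u : TreeVertex N R, w.1 <:+ u.1 → u ∈ S)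
    (hn : n + w.1.length ≤ R ∨ φ 0 = b) :
    pathRec φ b (truncTree N R) n S w = treeRec φ b N (min n (R - w.1.length)) w.1 := by
  classical
  induction n generalizing S w with
  | zero => simp [pathRec_zero, treeRec]
  | succ n ih =>
    rw [pathRec_succ]
    -- In the last generation the path recursion meets an empty sum and returns `φ 0`, while the
    -- tree recursion stops with `b`. This is the only place where the alternative in `hn` matters.
    rcases (show w.1.length ≤ R from w.2.2).eq_or_lt with hw | hw
    · have hφ : φ 0 = b := hn.resolve_left (by omega)
      rw [Finset.filter_eq_empty_iff.2, Finset.sum_empty, hφ]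
      · simp [hw, treeRec]
      · rintro u hu (⟨i, hi⟩ | ⟨i, hi⟩)
        · exact hpar u (Finset.mem_of_mem_erase hu) i hi
        · have h1 := u.2.2
          rw [hi, List.length_cons] at h1
          omega
    · obtain ⟨k, hk⟩ : ∃ k, R - w.1.length = k + 1 := ⟨R - w.1.length - 1, by omega⟩
      rw [hk, Nat.add_min_add_right, treeRec_succ]
      congr 1
      symm
      have hnode : ∀ i ∈ Finset.range (N w.1), IsNode N (i :: w.1) ∧ (i :: w.1).length ≤ R :=
        fun i hi => ⟨⟨Finset.mem_range.1 hi, w.2.1⟩, by rw [List.length_cons]; omega⟩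
      refine Finset.sum_bij (fun i hi => ⟨i :: w.1, hnode i hi⟩) ?_ ?_ ?_ ?_
      · intro i hi
        refine Finset.mem_filter.2 ⟨Finset.mem_erase.2 ⟨fun h => ?_, hdesc _ ?_⟩, Or.inr ⟨i, rfl⟩⟩
        · simpa using congrArg (fun u => u.1.length) h
        · exact List.suffix_cons i w.1
      · intro i hi j hj h
        exact (List.cons.inj (congrArg Subtype.val h)).1
      · intro u hu
        rw [Finset.mem_filter] at hu
        rcases hu.2 with ⟨i, hi⟩ | ⟨i, hi⟩
        · exact absurd hi (hpar u (Finset.mem_of_mem_erase hu.1) i)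
        · have h1 := u.2.1
          rw [hi] at h1
          exact ⟨i, Finset.mem_range.2 h1.1, treeVertex_ext hi.symm⟩
      · intro i hi
        rw [ih (S.erase w) ⟨i :: w.1, hnode i hi⟩]
        · congr 2
          change k = R - (i :: w.1).length
          rw [List.length_cons]
          omega
        · intro p hp j hj
          exact Finset.ne_of_mem_erase hp (treeVertex_ext (List.cons.inj hj).2.symm)
        · intro u hu
          refine Finset.mem_erase.2 ⟨?_, hdesc u ((List.suffix_cons i w.1).trans hu)⟩
          rintro rfl
          have := hu.length_le
          rw [List.length_cons] at this
          omega
        · refine hn.imp_left fun h => ?_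
          change n + (i :: w.1).length ≤ R
          rw [List.length_cons]
          omega

theorem pathRec_truncTree_root (φ : M → M) (b : M) (N : List ℕ → ℕ) {n R : ℕ}
    (hn : n ≤ R ∨ φ 0 = b) :
    pathRec φ b (truncTree N R) n Finset.univ (treeRoot N R) = treeRec φ b N (min n R) [] :=
  pathRec_truncTree φ b n Finset.univ (treeRoot N R) (by simp [treeRoot]) (by simp) hn

/-- The recursion for the monomer weights on a tree. -/
noncomputable def treeWeight (z : ℂ) (N : List ℕ → ℕ) (n : ℕ) : ℂ :=
  treeRec (fun s => (z + s)⁻¹) z⁻¹ N n []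

/-- The number of vertices in the generation `n` of a tree. -/
def generationSize (N : List ℕ → ℕ) (n : ℕ) : ℕ :=
  treeRec id 1 N n []

/-- The initial value `z⁻¹` equals `(z + 0)⁻¹`, the value at a leaf, so depth beyond the height `R`
changes nothing. -/
theorem monomerRec_truncTree (z : ℂ) (N : List ℕ → ℕ) (n R : ℕ) :
    monomerRec z (truncTree N R) n Finset.univ (treeRoot N R) = treeWeight z N (min n R) :=
  pathRec_truncTree_root _ _ N (Or.inr (by simp))

/-- Here an empty sum gives 0 whereas the initial value is 1, so the depth must stay within the
height. -/
theorem pathCount_truncTree (N : List ℕ → ℕ) {n R : ℕ} (hn : n ≤ R) :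
    pathCount (truncTree N R) n Finset.univ (treeRoot N R) = generationSize N n := by
  rw [pathCount, pathRec_truncTree_root _ _ N (Or.inl hn), min_eq_left hn, generationSize]

theorem monomerProb_truncTree {z : ℂ} (hz : 0 < z.re) (N : List ℕ → ℕ) (r : ℕ) :
    monomerProb (truncTree N r) z (treeRoot N r) = z * treeWeight z N r := by
  rw [monomerProb_eq _ hz _ (le_max_left _ r), monomerRec_truncTree, min_eq_right (le_max_right _ _)]

theorem norm_treeWeight_le {z : ℂ} (hz : 0 < z.re) (N : List ℕ → ℕ) (n : ℕ) :
    ‖treeWeight z N n‖ ≤ z.re⁻¹ := by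
  have := norm_monomerRec_le hz (truncTree N n) n Finset.univ (treeRoot N n)
  rwa [monomerRec_truncTree, min_self] at this

theorem norm_treeWeight_sub_le {z : ℂ} (hz : 0 < z.re) (N : List ℕ → ℕ) {r m : ℕ} (hrm : r ≤ m) :
    ‖treeWeight z N m - treeWeight z N r‖ ≤
      2 * z.re⁻¹ * ((z.re ^ 2)⁻¹ ^ r * generationSize N r) := by
  have := norm_monomerRec_sub_le hz (truncTree N m) hrm Finset.univ (treeRoot N m)
  rwa [monomerRec_truncTree, monomerRec_truncTree, pathCount_truncTree N hrm, min_self,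
    min_eq_left hrm] at this

/-- Measurability is asked only of the offspring numbers of `w` and its descendants, so the lemma
also applies to the σ-algebra they generate, as independence requires. -/
theorem measurable_treeRec {Ω : Type*} {m : MeasurableSpace Ω} [MeasurableSpace M]
    [MeasurableAdd₂ M] {φ : M → M} (hφ : Measurable φ) (b : M) {N : Ω → List ℕ → ℕ} (n : ℕ)
    (w : List ℕ) (hN : ∀ u, w <:+ u → Measurable fun ω => N ω u) :
    Measurable fun ω => treeRec φ b (N ω) n w := by
  induction n generalizing w with
  | zero => exact measurable_const
  | succ n ih =>
    simp only [treeRec_succ]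
    refine hφ.comp ?_
    have h : Measurable fun p : Ω × ℕ => ∑ i ∈ Finset.range p.2, treeRec φ b (N p.1) n (i :: w) :=
      measurable_from_prod_countable_left fun k =>
        Finset.measurable_fun_sum (Finset.range k) fun i _ =>
          ih (i :: w) fun u hu => hN u ((List.suffix_cons i w).trans hu)
    exact h.comp (measurable_id.prodMk (hN w List.suffix_rfl))

/-! ### Truncated trees as rooted graphs -/

theorem edist_treeRoot_le (N : List ℕ → ℕ) (r : ℕ) (w : List ℕ) (hw : IsNode N w ∧ w.length ≤ r) :
    (truncTree N r).edist (treeRoot N r) ⟨w, hw⟩ ≤ w.length := by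
  induction w with
  | nil => exact (SimpleGraph.edist_self (G := truncTree N r) (v := treeRoot N r)).le
  | cons i u ih =>
    have hu : IsNode N u ∧ u.length ≤ r := ⟨hw.1.2, (Nat.le_succ _).trans hw.2⟩
    have hadj : (truncTree N r).Adj ⟨u, hu⟩ ⟨i :: u, hw⟩ := Or.inr ⟨i, rfl⟩
    refine (SimpleGraph.edist_triangle (v := ⟨u, hu⟩)).trans ?_
    rw [SimpleGraph.edist_eq_one_iff_adj.2 hadj, List.length_cons, Nat.cast_succ]
    gcongr
    exact ih hu

/-- Sending a non-root vertex to the edge towards its parent is a bijection onto the edges; a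
connected graph with one edge fewer than vertices is a tree. -/
theorem isTree_truncTree (N : List ℕ → ℕ) (r : ℕ) : (truncTree N r).IsTree := by
  classical
  have hreach : ∀ v, (truncTree N r).Reachable (treeRoot N r) v := fun v =>
    SimpleGraph.edist_ne_top_iff_reachable.1
      (ne_top_of_le_ne_top (ENat.natCast_ne_top _) (edist_treeRoot_le N r v.1 v.2))
  have : Nonempty (TreeVertex N r) := ⟨treeRoot N r⟩
  rw [SimpleGraph.isTree_iff_connected_and_card]
  refine ⟨⟨fun u v => (hreach u).symm.trans (hreach v)⟩, ?_⟩
  have hpar : ∀ v : {v : TreeVertex N r // v ≠ treeRoot N r}, ∃ p : TreeVertex N r, ∃ i,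
      v.1.1 = i :: p.1 := by
    rintro ⟨⟨w, hw⟩, hne⟩
    rcases w with _ | ⟨i, u⟩
    · exact absurd rfl hne
    · exact ⟨⟨u, hw.1.2, (Nat.le_succ _).trans hw.2⟩, i, rfl⟩
  choose p i hp using hpar
  have hbij : Function.Bijective (fun v : {v : TreeVertex N r // v ≠ treeRoot N r} =>
      (⟨s(v.1, p v), Or.inl ⟨i v, hp v⟩⟩ : (truncTree N r).edgeSet)) := by
    constructor
    · intro v v' h
      rcases Sym2.eq_iff.1 (congrArg Subtype.val h) with ⟨h1, -⟩ | ⟨h1, h2⟩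
      · exact Subtype.ext h1
      · have e1 := congrArg List.length (hp v)
        have e2 := congrArg List.length (hp v')
        rw [h1, List.length_cons] at e1
        rw [← h2, List.length_cons] at e2
        omega
    · rintro ⟨e, he⟩
      induction e with
      | _ x y =>
        have main : ∀ a c : TreeVertex N r, ∀ j, a.1 = j :: c.1 →
            ∃ v : {v : TreeVertex N r // v ≠ treeRoot N r}, s(v.1, p v) = s(a, c) := by
          intro a c j hj
          have ha : a ≠ treeRoot N r := fun h => by simp [h, treeRoot] at hj
          have h1 : j :: c.1 = i ⟨a, ha⟩ :: (p ⟨a, ha⟩).1 := hj.symm.trans (hp ⟨a, ha⟩)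
          exact ⟨⟨a, ha⟩, by rw [← treeVertex_ext (List.cons.inj h1).2]⟩
        rcases he with ⟨j, hj⟩ | ⟨j, hj⟩
        · obtain ⟨v, hv⟩ := main x y j hj
          exact ⟨v, Subtype.ext hv⟩
        · obtain ⟨v, hv⟩ := main y x j hj
          exact ⟨v, Subtype.ext (hv.trans Sym2.eq_swap)⟩
  rw [← Nat.card_congr (Equiv.ofBijective _ hbij), Nat.card_eq_fintype_card,
    Nat.card_eq_fintype_card, Fintype.card_subtype_compl, Fintype.card_subtype_eq]
  have : 0 < Fintype.card (TreeVertex N r) := Fintype.card_pos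
  omega

theorem RootedIso.symm {V W : Type*} {G : SimpleGraph V} {o : V} {H : SimpleGraph W} {p : W}
    (h : RootedIso G o H p) : RootedIso H p G o := by
  obtain ⟨e, rfl⟩ := h
  exact ⟨e.symm, e.symm_apply_apply o⟩

theorem RootedIso.trans {U V W : Type*} {F : SimpleGraph U} {q : U} {G : SimpleGraph V} {o : V}
    {H : SimpleGraph W} {p : W} (h : RootedIso F q G o) (h' : RootedIso G o H p) :
    RootedIso F q H p := by
  obtain ⟨e, rfl⟩ := h
  obtain ⟨e', rfl⟩ := h'
  exact ⟨e.trans e', rfl⟩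

/-- Trees with the same vertices are isomorphic. -/
theorem rootedIso_truncTree_of_isNode_iff {N N' : List ℕ → ℕ} {r : ℕ}
    (h : ∀ w, (IsNode N w ∧ w.length ≤ r) ↔ (IsNode N' w ∧ w.length ≤ r)) :
    RootedIso (truncTree N r) (treeRoot N r) (truncTree N' r) (treeRoot N' r) :=
  ⟨⟨Equiv.subtypeEquivRight h, Iff.rfl⟩, rfl⟩

end Tree

/-! ### Generation sizes of Galton-Watson trees -/

section GaltonWatson

variable {Ω : Type*} [MeasurableSpace Ω] {μ : Measure Ω} {N : Ω → List ℕ → ℕ} {P ρ : PMF ℕ}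

theorem lintegral_natCast_eq_pmfMean {X : Ω → ℕ} (hX : Measurable X) {Q : PMF ℕ}
    (h : μ.map X = Q.toMeasure) : ∫⁻ ω, (X ω : ℝ≥0∞) ∂μ = pmfMean Q := by
  have h1 : ∫⁻ ω, (X ω : ℝ≥0∞) ∂μ = ∫⁻ k : ℕ, (k : ℝ≥0∞) ∂(μ.map X) :=
    (lintegral_map (measurable_of_countable _) hX).symm
  rw [h1, h, lintegral_countable', pmfMean]
  simp [PMF.toMeasure_apply_singleton]

theorem IsGaltonWatson.measurable_treeRec (hN : IsGaltonWatson μ N P ρ) {M : Type*}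
    [AddCommMonoid M] [MeasurableSpace M] [MeasurableAdd₂ M] {φ : M → M} (hφ : Measurable φ) (b : M)
    (n : ℕ) (w : List ℕ) : Measurable fun ω => treeRec φ b (N ω) n w :=
  MonomerDimer.measurable_treeRec hφ b n w fun u _ => hN.measurable u

theorem IsGaltonWatson.indepFun_treeRec (hN : IsGaltonWatson μ N P ρ)
    {M : Type*} [AddCommMonoid M] [MeasurableSpace M] [MeasurableAdd₂ M] {φ : M → M}
    (hφ : Measurable φ) (b : M) (n i : ℕ) (w : List ℕ) :
    IndepFun (fun ω => N ω w) (fun ω => treeRec φ b (N ω) n (i :: w)) μ := by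
  have hind := indep_iSup_of_disjoint (m := fun u => MeasurableSpace.comap (fun ω => N ω u) ⊤)
    (fun u => (hN.measurable u).comap_le) ((iIndepFun_iff_iIndep _ _ _).1 hN.indep)
    (S := {w}) (T := {u | i :: w <:+ u}) (by
      rw [Set.disjoint_singleton_left]
      intro h
      have := List.IsSuffix.length_le h
      rw [List.length_cons] at this
      omega)
  rw [IndepFun_iff_Indep]
  refine indep_of_indep_of_le_left (indep_of_indep_of_le_right hind ?_) ?_
  · refine Measurable.comap_le ?_
    refine MonomerDimer.measurable_treeRec hφ b n (i :: w) fun u hu => ?_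
    exact (comap_measurable fun ω => N ω u).mono
      (le_iSup₂_of_le (f := fun u _ => MeasurableSpace.comap (fun ω => N ω u) ⊤) u hu le_rfl) le_rfl
  · exact le_iSup₂_of_le (f := fun u _ => MeasurableSpace.comap (fun ω => N ω u) ⊤) w rfl le_rfl

/-- Wald's identity: the count is $\sum_i\mathbf 1(i<N_w)X_i$, where $X_i$ depends only on offspring
numbers at and below `i :: w` and is thus independent of $N_w$. -/
theorem IsGaltonWatson.lintegral_descendants_succ (hN : IsGaltonWatson μ N P ρ) {Q : PMF ℕ}
    {w : List ℕ} (hw : μ.map (fun ω => N ω w) = Q.toMeasure) {n : ℕ} {c : ℝ≥0∞}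
    (hc : ∀ i, ∫⁻ ω, (treeRec id 1 (N ω) n (i :: w) : ℕ) ∂μ = c) :
    ∫⁻ ω, (treeRec id 1 (N ω) (n + 1) w : ℕ) ∂μ = pmfMean Q * c := by
  have hcast : Measurable fun k : ℕ => (k : ℝ≥0∞) := measurable_of_countable _
  have hsum : ∀ ω, ((treeRec id 1 (N ω) (n + 1) w : ℕ) : ℝ≥0∞) =
      ∑' i : ℕ, (if i < N ω w then 1 else 0) * ((treeRec id 1 (N ω) n (i :: w) : ℕ) : ℝ≥0∞) := by
    intro ω
    rw [treeRec_succ, id, Nat.cast_sum, tsum_eq_sum (s := Finset.range (N ω w))]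
    · refine Finset.sum_congr rfl fun i hi => ?_
      rw [if_pos (Finset.mem_range.1 hi), one_mul]
    · intro i hi
      rw [if_neg (by simpa using hi), zero_mul]
  have hind : ∀ i, Measurable fun k : ℕ => if i < k then (1 : ℝ≥0∞) else 0 := fun i =>
    measurable_of_countable _
  have hm : ∀ i, Measurable fun ω => if i < N ω w then (1 : ℝ≥0∞) else 0 := fun i =>
    (hind i).comp (hN.measurable w)
  have hg : ∀ i, Measurable fun ω => ((treeRec id 1 (N ω) n (i :: w) : ℕ) : ℝ≥0∞) := fun i =>
    hcast.comp (hN.measurable_treeRec measurable_id 1 n (i :: w))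
  have hprod : ∀ i, ∫⁻ ω, (if i < N ω w then (1 : ℝ≥0∞) else 0) *
      ((treeRec id 1 (N ω) n (i :: w) : ℕ) : ℝ≥0∞) ∂μ =
      (∫⁻ ω, (if i < N ω w then (1 : ℝ≥0∞) else 0) ∂μ) * c := by
    intro i
    rw [← hc i]
    exact lintegral_mul_eq_lintegral_mul_lintegral_of_indepFun (hm i) (hg i)
      ((hN.indepFun_treeRec measurable_id 1 n i w).comp (hind i) hcast)
  have hmg : ∀ i, AEMeasurable (fun ω => (if i < N ω w then (1 : ℝ≥0∞) else 0) *
      ((treeRec id 1 (N ω) n (i :: w) : ℕ) : ℝ≥0∞)) μ := fun i => ((hm i).mul (hg i)).aemeasurable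
  simp_rw [hsum]
  rw [lintegral_tsum hmg]
  simp_rw [hprod]
  rw [ENNReal.tsum_mul_right, ← lintegral_tsum fun i => (hm i).aemeasurable,
    ← lintegral_natCast_eq_pmfMean (hN.measurable w) hw]
  congr 1
  refine lintegral_congr fun ω => ?_
  rw [tsum_eq_sum (s := Finset.range (N ω w)) fun i hi => if_neg (by simpa using hi)]
  rw [Finset.sum_congr rfl fun i hi => if_pos (Finset.mem_range.1 hi)]
  simp

theorem IsGaltonWatson.lintegral_descendants [IsProbabilityMeasure μ]
    (hN : IsGaltonWatson μ N P ρ) (n : ℕ) (w : List ℕ) (hw : w ≠ []) :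
    ∫⁻ ω, (treeRec id 1 (N ω) n w : ℕ) ∂μ = pmfMean ρ ^ n := by
  induction n generalizing w with
  | zero => simp [treeRec]
  | succ n ih =>
    rw [hN.lintegral_descendants_succ (hN.law_other w hw) fun i => ih (i :: w) (by simp), pow_succ']

theorem IsGaltonWatson.lintegral_generationSize_succ [IsProbabilityMeasure μ]
    (hN : IsGaltonWatson μ N P ρ) (n : ℕ) :
    ∫⁻ ω, (generationSize (N ω) (n + 1) : ℝ≥0∞) ∂μ = pmfMean P * pmfMean ρ ^ n :=
  hN.lintegral_descendants_succ hN.law_root fun i => hN.lintegral_descendants n [i] (by simp)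

/-- Unimodularity and a finite second moment of the root degree give a finite offspring mean. -/
theorem pmfMean_mul_pmfMean_ne_top (hunim : IsUnimodular P ρ)
    (hsecond : ∑' k : ℕ, (k : ℝ≥0∞) ^ 2 * P k ≠ ⊤) : pmfMean P * pmfMean ρ ≠ ⊤ := by
  refine ne_top_of_le_ne_top hsecond ?_
  rw [pmfMean.eq_1 ρ, ← ENNReal.tsum_mul_left]
  calc ∑' k : ℕ, pmfMean P * ((k : ℝ≥0∞) * ρ k)
      ≤ ∑' k : ℕ, ((k + 1 : ℕ) : ℝ≥0∞) ^ 2 * P (k + 1) := by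
        refine ENNReal.tsum_le_tsum fun k => ?_
        rw [mul_left_comm, hunim.2 k, ← mul_assoc, sq, Nat.cast_succ]
        gcongr
        exact le_self_add
    _ ≤ ∑' k : ℕ, (k : ℝ≥0∞) ^ 2 * P k :=
        ENNReal.tsum_comp_le_tsum_of_injective (add_left_injective 1)
          fun k : ℕ => (k : ℝ≥0∞) ^ 2 * P k

/-- The mean generation sizes grow at most geometrically. -/
theorem IsGaltonWatson.exists_lintegral_generationSize_le [IsProbabilityMeasure μ]
    (hN : IsGaltonWatson μ N P ρ) (hunim : IsUnimodular P ρ)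
    (hsecond : ∑' k : ℕ, (k : ℝ≥0∞) ^ 2 * P k ≠ ⊤) :
    ∃ C B : ℝ≥0∞, C ≠ ⊤ ∧ B ≠ ⊤ ∧
      ∀ n, ∫⁻ ω, (generationSize (N ω) n : ℝ≥0∞) ∂μ ≤ C * B ^ n := by
  have h0 : ∫⁻ ω, (generationSize (N ω) 0 : ℝ≥0∞) ∂μ = 1 := by
    simp [generationSize, treeRec]
  -- When the root has no offspring in the mean, unimodularity says nothing about `ρ`, whose mean
  -- may be infinite; the later generations still have mean zero.
  by_cases hP : pmfMean P = 0
  · refine ⟨1, 1, by simp, by simp, fun n => ?_⟩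
    cases n with
    | zero => rw [h0]; simp
    | succ n => rw [hN.lintegral_generationSize_succ, hP]; simp
  · have hρ : pmfMean ρ ≠ ⊤ := fun h =>
      pmfMean_mul_pmfMean_ne_top hunim hsecond (by rw [h, ENNReal.mul_top hP])
    refine ⟨1 + pmfMean P, 1 + pmfMean ρ, by simp [hunim.1], by simp [hρ], fun n => ?_⟩
    cases n with
    | zero => rw [h0, pow_zero, mul_one]; exact le_self_add
    | succ n =>
      rw [hN.lintegral_generationSize_succ]
      have h1 : pmfMean ρ ^ n ≤ (1 + pmfMean ρ) ^ (n + 1) :=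
        (pow_le_pow_left' le_add_self n).trans (pow_le_pow_right₀ le_self_add n.le_succ)
      exact mul_le_mul' le_add_self h1

/-- For a large activity, the weighted generation sizes are summable in the mean. -/
theorem IsGaltonWatson.exists_sum_lintegral_lt_top [IsProbabilityMeasure μ]
    (hN : IsGaltonWatson μ N P ρ) (hunim : IsUnimodular P ρ)
    (hsecond : ∑' k : ℕ, (k : ℝ≥0∞) ^ 2 * P k ≠ ⊤) :
    ∃ a : ℝ, 0 < a ∧ ∑' n : ℕ, ∫⁻ ω,
      ENNReal.ofReal ((a ^ 2)⁻¹ ^ n * generationSize (N ω) n) ∂μ ≠ ⊤ := by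
  obtain ⟨C, B, hC, hB, h⟩ := hN.exists_lintegral_generationSize_le hunim hsecond
  lift B to NNReal using hB
  have hB0 : (0 : ℝ) ≤ B := B.2
  -- With $a=B+1$ the ratio $B/a^2$ is below 1, so the means are dominated by a convergent geometric
  -- series.
  refine ⟨B + 1, by positivity, ?_⟩
  have hx : (0 : ℝ) ≤ ((B + 1 : ℝ) ^ 2)⁻¹ := by positivity
  have hle : ∀ n : ℕ, ∫⁻ ω, ENNReal.ofReal (((B + 1 : ℝ) ^ 2)⁻¹ ^ n * generationSize (N ω) n) ∂μ ≤
      C * ENNReal.ofReal (((B + 1 : ℝ) ^ 2)⁻¹ * B) ^ n := by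
    intro n
    have hcast : Measurable fun k : ℕ => (k : ℝ≥0∞) := measurable_of_countable _
    have hm : Measurable fun ω => (generationSize (N ω) n : ℝ≥0∞) :=
      hcast.comp (hN.measurable_treeRec measurable_id 1 n [])
    simp_rw [ENNReal.ofReal_mul (pow_nonneg hx n), ENNReal.ofReal_natCast]
    rw [lintegral_const_mul _ hm,
      ENNReal.ofReal_pow hx, ENNReal.ofReal_mul hx, mul_pow, ENNReal.ofReal_coe_nnreal,
      mul_left_comm]
    gcongr
    exact h n
  refine ne_top_of_le_ne_top ?_ (ENNReal.tsum_le_tsum hle)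
  rw [ENNReal.tsum_mul_left]
  rw [ENNReal.tsum_geometric]
  refine ENNReal.mul_ne_top hC (ENNReal.inv_ne_top.2 (tsub_pos_of_lt ?_).ne')
  rw [ENNReal.ofReal_lt_one, inv_mul_eq_div, div_lt_one (by positivity)]
  nlinarith

end GaltonWatson

/-! ### The limit of the root weights on a Galton-Watson tree -/

section Limit

variable {Ω : Type*} [MeasurableSpace Ω] {μ : Measure Ω} {N : Ω → List ℕ → ℕ} {P ρ : PMF ℕ}

/-- The truncation error gives a Cauchy sequence for $\Re z>a$, and Vitali extends convergence to
the half-plane. The hypothesis does not involve `z`, so a single almost sure event serves all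
activities. -/
theorem tendsto_treeLimit {N : List ℕ → ℕ} {a : ℝ} (ha : 0 < a)
    (h : Tendsto (fun n : ℕ => (a ^ 2)⁻¹ ^ n * (generationSize N n : ℝ)) atTop (𝓝 0)) {z : ℂ}
    (hz : z ∈ rightHalfPlane) :
    Tendsto (fun r : ℕ => monomerProb (truncTree N r) z (treeRoot N r)) atTop
      (𝓝 (treeLimit N z)) := by
  obtain ⟨F, hF⟩ := exists_tendstoLocallyUniformlyOn
    (f := fun r z => monomerProb (truncTree N r) z (treeRoot N r)) (a := a) zero_le_one
    (fun r => differentiableOn_monomerProb _ _)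
    (fun r z hz => by rw [one_mul]; exact norm_monomerProb_le _ _ hz) (by
      intro z hz
      have hz0 : 0 < z.re := ha.trans hz
      have key : ∀ n m, n ≤ m → dist (monomerProb (truncTree N m) z (treeRoot N m))
          (monomerProb (truncTree N n) z (treeRoot N n)) ≤
          ‖z‖ * (2 * z.re⁻¹) * ((a ^ 2)⁻¹ ^ n * (generationSize N n : ℝ)) := by
        intro n m hnm
        rw [monomerProb_truncTree hz0, monomerProb_truncTree hz0, dist_eq_norm, ← mul_sub,
          norm_mul, mul_assoc]
        refine mul_le_mul_of_nonneg_left ((norm_treeWeight_sub_le hz0 N hnm).trans ?_)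
          (norm_nonneg z)
        gcongr
      refine cauchySeq_of_le_tendsto_0
        (fun n => 2 * (‖z‖ * (2 * z.re⁻¹) * ((a ^ 2)⁻¹ ^ n * (generationSize N n : ℝ))))
        (fun n m k hn hm => ?_) (by simpa using (h.const_mul (‖z‖ * (2 * z.re⁻¹))).const_mul 2)
      refine (dist_triangle_right _ _ (monomerProb (truncTree N k) z (treeRoot N k))).trans ?_
      linarith [key k n hn, key k m hm])
  have h1 := hF.tendsto_at hz
  rwa [treeLimit, h1.limUnder_eq]

theorem IsGaltonWatson.measurable_generationSize (hN : IsGaltonWatson μ N P ρ) (n : ℕ) :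
    Measurable fun ω => generationSize (N ω) n :=
  hN.measurable_treeRec measurable_id 1 n []

theorem IsGaltonWatson.measurable_treeWeight (hN : IsGaltonWatson μ N P ρ) (z : ℂ) (n : ℕ) :
    Measurable fun ω => treeWeight z (N ω) n :=
  hN.measurable_treeRec (measurable_const.add measurable_id).inv z⁻¹ n []

theorem IsGaltonWatson.ae_tendsto_generationSize (hN : IsGaltonWatson μ N P ρ) {a : ℝ}
    (h : ∑' n : ℕ, ∫⁻ ω, ENNReal.ofReal ((a ^ 2)⁻¹ ^ n * generationSize (N ω) n) ∂μ ≠ ⊤) :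
    ∀ᵐ ω ∂μ, Tendsto (fun n : ℕ => (a ^ 2)⁻¹ ^ n * (generationSize (N ω) n : ℝ)) atTop (𝓝 0) := by
  have hm : ∀ n : ℕ, Measurable fun ω =>
      ENNReal.ofReal ((a ^ 2)⁻¹ ^ n * generationSize (N ω) n) := fun n =>
    (measurable_of_countable fun k : ℕ => ENNReal.ofReal ((a ^ 2)⁻¹ ^ n * (k : ℝ))).comp
      (hN.measurable_generationSize n)
  rw [← lintegral_tsum fun n => (hm n).aemeasurable] at h
  filter_upwards [ae_lt_top (Measurable.tsum hm) h] with ω hω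
  have h1 := (ENNReal.tendsto_toReal ENNReal.zero_ne_top).comp
    (ENNReal.tendsto_atTop_zero_of_tsum_ne_top hω.ne)
  refine h1.congr fun n => ?_
  rw [Function.comp, ENNReal.toReal_ofReal (by positivity)]

theorem norm_mul_treeWeight_le {z : ℂ} (hz : 0 < z.re) (N : List ℕ → ℕ) (n : ℕ) :
    ‖z * treeWeight z N n‖ ≤ ‖z‖ / z.re := by
  rw [norm_mul, div_eq_mul_inv]
  gcongr
  exact norm_treeWeight_le hz N n

variable [IsProbabilityMeasure μ]

theorem IsGaltonWatson.integrable_treeLimit (hN : IsGaltonWatson μ N P ρ) {z : ℂ}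
    (hz : z ∈ rightHalfPlane)
    (h : ∀ᵐ ω ∂μ, Tendsto (fun r : ℕ => monomerProb (truncTree (N ω) r) z (treeRoot (N ω) r)) atTop
      (𝓝 (treeLimit (N ω) z))) :
    Integrable (fun ω => treeLimit (N ω) z) μ := by
  simp only [monomerProb_truncTree hz] at h
  refine Integrable.of_bound (C := ‖z‖ / z.re) ?_ ?_
  · exact aestronglyMeasurable_of_tendsto_ae atTop
      (fun n => ((hN.measurable_treeWeight z n).const_mul z).aestronglyMeasurable) h
  · filter_upwards [h] with ω hω
    exact le_of_tendsto hω.norm (Eventually.of_forall fun n => norm_mul_treeWeight_le hz _ n)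

theorem IsGaltonWatson.tendsto_integral_treeWeight (hN : IsGaltonWatson μ N P ρ) {z : ℂ}
    (hz : z ∈ rightHalfPlane)
    (h : ∀ᵐ ω ∂μ, Tendsto (fun r : ℕ => monomerProb (truncTree (N ω) r) z (treeRoot (N ω) r)) atTop
      (𝓝 (treeLimit (N ω) z))) :
    Tendsto (fun r => ∫ ω, z * treeWeight z (N ω) r ∂μ) atTop (𝓝 (∫ ω, treeLimit (N ω) z ∂μ)) := by
  simp only [monomerProb_truncTree hz] at h
  exact tendsto_integral_of_dominated_convergence (fun _ => ‖z‖ / z.re)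
    (fun n => ((hN.measurable_treeWeight z n).const_mul z).aestronglyMeasurable)
    (integrable_const _) (fun n => Eventually.of_forall fun ω => norm_mul_treeWeight_le hz _ n) h

end Limit

/-! ### Averages over the vertices and local convergence -/

/-- Convergence of the frequencies of the values of a discrete statistic to a probability
distribution implies the convergence of the averages of bounded functions of the statistic. -/
theorem tendsto_average_of_tendsto_frequency {Ω : Type*} [MeasurableSpace Ω] {μ : Measure Ω}
    [IsProbabilityMeasure μ] {Q : Type*} [Countable Q] [MeasurableSpace Q]
    [MeasurableSingletonClass Q] {V : ℕ → Type*} [∀ n, Fintype (V n)] [∀ n, Nonempty (V n)]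
    (c : ∀ n, V n → Q) {X : Ω → Q} (hX : Measurable X)
    (hc : ∀ q ∈ Set.range X, Tendsto
      (fun n => (Nat.card {v : V n // c n v = q} : ℝ) / Fintype.card (V n)) atTop
      (𝓝 (μ.real {ω | X ω = q})))
    {h : Q → ℂ} {B : ℝ} (hB : ∀ q, ‖h q‖ ≤ B) :
    Tendsto (fun n => (∑ v, h (c n v)) / (Fintype.card (V n) : ℂ)) atTop
      (𝓝 (∫ ω, h (X ω) ∂μ)) := by
  classical
  have hB0 : 0 ≤ B := by
    obtain ⟨ω⟩ : Nonempty Ω := μ.nonempty_of_neZero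
    exact (norm_nonneg _).trans (hB (X ω))
  have hmeas : ∀ q, MeasurableSet {ω | X ω = q} := fun q => hX (measurableSet_singleton q)
  have hh : Measurable h := measurable_of_countable h
  have hdisj : Pairwise (Function.onFun Disjoint fun q => {ω | X ω = q}) := fun p q hpq =>
    Set.disjoint_left.2 fun ω hp hq => hpq (Eq.trans (Eq.symm hp) hq)
  have hfin : ∀ ε : ℝ, 0 < ε → ∃ F : Finset Q, (∀ q ∈ F, q ∈ Set.range X) ∧
      1 - ε < μ.real {ω | X ω ∈ F} := by
    intro ε hε
    have hsum : HasSum (fun q => μ.real {ω | X ω = q}) 1 := by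
      have h1 : ∑' q, μ {ω | X ω = q} = 1 := by
        rw [← measure_iUnion hdisj hmeas]
        have : ⋃ q, {ω | X ω = q} = Set.univ := by ext; simp
        rw [this, measure_univ]
      have h2 := ENNReal.hasSum_toReal (h1.trans_ne ENNReal.one_ne_top)
      rwa [← ENNReal.tsum_toReal_eq fun q => measure_ne_top _ _, h1, ENNReal.toReal_one] at h2
    obtain ⟨F, hF⟩ := (hsum.eventually_const_lt (sub_lt_self 1 hε)).exists
    -- Convergence of frequencies is assumed only for values that `X` takes; discarding the others
    -- loses no mass.
    refine ⟨F.filter (· ∈ Set.range X), fun q hq => (Finset.mem_filter.1 hq).2, hF.trans_eq ?_⟩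
    have : {ω | X ω ∈ F.filter (· ∈ Set.range X)} = ⋃ q ∈ F, {ω | X ω = q} := by
      ext ω; simp
    rw [this, measureReal_biUnion_finset (fun p _ q _ hpq => hdisj hpq) fun q _ => hmeas q]
  have hcard : ∀ n, (0 : ℝ) < Fintype.card (V n) := fun n => by exact_mod_cast Fintype.card_pos
  -- frequencies of finite sets of values
  have hfreq : ∀ (F : Finset Q), (∀ q ∈ F, q ∈ Set.range X) → ∀ g : Q → ℂ,
      Tendsto (fun n => (∑ v, if c n v ∈ F then g (c n v) else 0) / (Fintype.card (V n) : ℂ))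
        atTop (𝓝 (∫ ω, (if X ω ∈ F then g (X ω) else 0) ∂μ)) := by
    intro F hF g
    have h1 : ∀ n, (∑ v, if c n v ∈ F then g (c n v) else 0) / (Fintype.card (V n) : ℂ) =
        ∑ q ∈ F, (((Nat.card {v : V n // c n v = q} : ℝ) / Fintype.card (V n) : ℝ) : ℂ) * g q := by
      intro n
      rw [← Finset.sum_filter, ← Finset.sum_fiberwise_of_maps_to (t := F) (g := c n)
        (fun v hv => (Finset.mem_filter.1 hv).2), Finset.sum_div]
      refine Finset.sum_congr rfl fun q hq => ?_
      rw [Finset.sum_congr rfl (g := fun _ => g q) fun v hv => by rw [(Finset.mem_filter.1 hv).2],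
        Finset.sum_const, nsmul_eq_mul, Nat.card_eq_fintype_card, Fintype.card_subtype,
        Finset.filter_filter]
      have : Finset.univ.filter (fun v => c n v ∈ F ∧ c n v = q) =
          Finset.univ.filter (fun v => c n v = q) :=
        Finset.filter_congr fun v _ => ⟨fun h => h.2, fun h => ⟨h ▸ hq, h⟩⟩
      rw [this]
      push_cast
      ring
    have h2 : ∫ ω, (if X ω ∈ F then g (X ω) else 0) ∂μ =
        ∑ q ∈ F, ((μ.real {ω | X ω = q} : ℝ) : ℂ) * g q := by
      have : ∀ ω, (if X ω ∈ F then g (X ω) else 0) =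
          ∑ q ∈ F, ({ω | X ω = q} : Set Ω).indicator (fun _ => g q) ω := by
        intro ω
        simp only [Set.indicator, Set.mem_ofPred_eq]
        rw [Finset.sum_ite_eq]
      simp_rw [this]
      rw [integral_finsetSum _ fun q _ => (integrable_const _).indicator (hmeas q)]
      refine Finset.sum_congr rfl fun q _ => ?_
      rw [integral_indicator_const _ (hmeas q), Complex.real_smul]
    simp_rw [h1, h2]
    refine tendsto_finsetSum _ fun q hq => Tendsto.mul_const _ ?_
    exact (Complex.continuous_ofReal.tendsto _).comp (hc q (hF q hq))
  rw [Metric.tendsto_atTop']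
  intro ε hε
  -- The error budget: `B * δ` for vertices whose value is outside `F`, `δ` for the averages
  -- restricted to `F`, and `B * δ` for the integral outside `F`. Convergence of the frequency of
  -- `F` itself prevents mass from escaping.
  obtain ⟨δ, hδ, hδε⟩ : ∃ δ : ℝ, 0 < δ ∧ B * δ + δ + B * δ < ε := by
    refine ⟨ε / (2 * (1 + 2 * B)), by positivity, ?_⟩
    have : ε / (2 * (1 + 2 * B)) * (1 + 2 * B) = ε / 2 := by field_simp
    linarith
  obtain ⟨F, hFX, hF⟩ := hfin δ hδ
  have hm : MeasurableSet {ω | X ω ∈ F} := hX F.measurableSet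
  have hind : ∀ g : Q → ℂ, (fun ω => if X ω ∈ F then g (X ω) else 0) =
      {ω | X ω ∈ F}.indicator fun ω => g (X ω) := fun g => by
    ext ω
    simp [Set.indicator]
  have e1 := hfreq F hFX h
  have e2 := hfreq F hFX fun _ => 1
  have hp : ∫ ω, (if X ω ∈ F then (1 : ℂ) else 0) ∂μ = (μ.real {ω | X ω ∈ F} : ℝ) := by
    have := integral_indicator_const (μ := μ) (1 : ℂ) hm
    rw [Complex.real_smul, mul_one] at this
    rw [← this, hind fun _ => 1]
  rw [hp] at e2
  have e3 := ((Complex.continuous_re.tendsto _).comp e2).eventually_const_lt hF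
  rw [Metric.tendsto_atTop'] at e1
  obtain ⟨n₀, hn₀⟩ := e1 δ hδ
  obtain ⟨n₁, hn₁⟩ := eventually_atTop.1 e3
  refine ⟨max n₀ n₁, fun n hn => ?_⟩
  have f1 := hn₀ n ((le_max_left _ _).trans_lt hn)
  have f2 := hn₁ n ((le_max_right _ _).trans hn.le)
  have g1 : dist ((∑ v, h (c n v)) / (Fintype.card (V n) : ℂ))
      ((∑ v, if c n v ∈ F then h (c n v) else 0) / (Fintype.card (V n) : ℂ)) ≤ B * δ := by
    have f3 : 1 - δ < (∑ v : V n, if c n v ∈ F then (1 : ℝ) else 0) / Fintype.card (V n) := by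
      refine f2.trans_eq ?_
      have : ((∑ v : V n, if c n v ∈ F then (1 : ℂ) else 0) / (Fintype.card (V n) : ℂ)) =
          (((∑ v : V n, if c n v ∈ F then (1 : ℝ) else 0) / Fintype.card (V n) : ℝ) : ℂ) := by
        push_cast
        congr 1
        exact Finset.sum_congr rfl fun v _ => by split_ifs <;> simp
      rw [Function.comp_apply, this, Complex.ofReal_re]
    rw [dist_eq_norm, ← sub_div, ← Finset.sum_sub_distrib, norm_div, Complex.norm_natCast,
      div_le_iff₀ (hcard n)]
    rw [lt_div_iff₀ (hcard n)] at f3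
    calc ‖∑ v, (h (c n v) - if c n v ∈ F then h (c n v) else 0)‖
        ≤ ∑ v : V n, B * (1 - if c n v ∈ F then (1 : ℝ) else 0) := by
          refine norm_sum_le_of_le _ fun v _ => ?_
          split_ifs <;> simp [hB]
      _ = B * (Fintype.card (V n) - ∑ v : V n, if c n v ∈ F then (1 : ℝ) else 0) := by
          rw [← Finset.mul_sum, Finset.sum_sub_distrib]
          simp
      _ ≤ B * δ * Fintype.card (V n) := by
          rw [mul_assoc]
          refine mul_le_mul_of_nonneg_left ?_ hB0
          linarith
  have g2 : dist (∫ ω, (if X ω ∈ F then h (X ω) else 0) ∂μ) (∫ ω, h (X ω) ∂μ) ≤ B * δ := by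
    have hhX : Integrable (fun ω => h (X ω)) μ :=
      Integrable.of_bound (hh.comp hX).aestronglyMeasurable B (Eventually.of_forall fun ω => hB _)
    have hhF : Integrable (fun ω => if X ω ∈ F then h (X ω) else 0) μ := by
      rw [hind h]
      exact hhX.indicator hm
    rw [dist_comm, dist_eq_norm, ← integral_sub hhX hhF]
    have hi : Integrable ({ω | X ω ∈ F}ᶜ.indicator fun _ => B) μ :=
      (integrable_const B).indicator hm.compl
    refine (norm_integral_le_of_norm_le hi (Eventually.of_forall fun ω => ?_)).trans ?_
    · by_cases hω : X ω ∈ F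
      · simp [hω]
      · simpa [hω] using hB _
    · rw [integral_indicator_const _ hm.compl, smul_eq_mul, probReal_compl_eq_one_sub hm, mul_comm]
      exact mul_le_mul_of_nonneg_left (by linarith) hB0
  have t1 := dist_triangle ((∑ v, h (c n v)) / (Fintype.card (V n) : ℂ))
    ((∑ v, if c n v ∈ F then h (c n v) else 0) / (Fintype.card (V n) : ℂ)) (∫ ω, h (X ω) ∂μ)
  have t2 := dist_triangle ((∑ v, if c n v ∈ F then h (c n v) else 0) / (Fintype.card (V n) : ℂ))
    (∫ ω, (if X ω ∈ F then h (X ω) else 0) ∂μ) (∫ ω, h (X ω) ∂μ)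
  linarith

/-! ### Isomorphism classes of finite rooted graphs -/

theorem edist_iso_le {V W : Type*} {G : SimpleGraph V} {H : SimpleGraph W} (e : G ≃g H) (u v : V) :
    H.edist (e u) (e v) ≤ G.edist u v := by
  by_cases h : G.edist u v = ⊤
  · rw [h]; exact le_top
  · obtain ⟨p, hp⟩ := SimpleGraph.exists_walk_of_edist_ne_top h
    rw [← hp]
    refine (SimpleGraph.edist_le (p.map e.toHom)).trans ?_
    rw [SimpleGraph.Walk.length_map]

/-- Rooted isomorphism on the finite rooted graphs with vertex sets `Fin m`. -/
instance rootedSetoid : Setoid (Σ m : ℕ, SimpleGraph (Fin m) × Fin m) where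
  r p q := RootedIso p.2.1 p.2.2 q.2.1 q.2.2
  iseqv := ⟨fun _ => ⟨SimpleGraph.Iso.refl, rfl⟩, RootedIso.symm, RootedIso.trans⟩

/-- Isomorphism classes of finite rooted graphs. -/
def RootedClass : Type := Quotient rootedSetoid

instance : Countable RootedClass :=
  inferInstanceAs (Countable (Quotient rootedSetoid))

instance : MeasurableSpace RootedClass := ⊤

instance : MeasurableSingletonClass RootedClass := ⟨fun _ => trivial⟩

/-- The class of the rooted graph `(T, o)`. -/
def RootedClass.mk {m : ℕ} (T : SimpleGraph (Fin m)) (o : Fin m) : RootedClass :=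
  Quotient.mk rootedSetoid ⟨m, T, o⟩

/-- The isomorphism class of a finite rooted graph. -/
noncomputable def rootedClass {V : Type*} [Fintype V] (G : SimpleGraph V) (o : V) : RootedClass :=
  RootedClass.mk (G.map (Fintype.equivFin V)) (Fintype.equivFin V o)

theorem rootedClass_eq_mk_iff {V : Type*} [Fintype V] {G : SimpleGraph V} {o : V} {m : ℕ}
    {T : SimpleGraph (Fin m)} {p : Fin m} :
    rootedClass G o = RootedClass.mk T p ↔ RootedIso G o T p := by
  have h : RootedIso G o (G.map (Fintype.equivFin V)) (Fintype.equivFin V o) :=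
    ⟨SimpleGraph.Iso.map (Fintype.equivFin V) G, rfl⟩
  refine Iff.trans (Quotient.eq (r := rootedSetoid)) ⟨fun h' => h.trans h', fun h' => h.symm.trans h'⟩

/-- The path recursion as a function of the isomorphism class. -/
noncomputable def RootedClass.pathRec {M : Type*} [AddCommMonoid M] (φ : M → M) (b : M) (n : ℕ) :
    RootedClass → M :=
  Quotient.lift (fun p => MonomerDimer.pathRec φ b p.2.1 n Finset.univ p.2.2)
    fun _ _ h => pathRec_of_rootedIso φ b h n

theorem pathRec_rootedClass {M : Type*} [AddCommMonoid M] (φ : M → M) (b : M) (n : ℕ) {V : Type*}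
    [Fintype V] (G : SimpleGraph V) (o : V) :
    (rootedClass G o).pathRec φ b n = pathRec φ b G n Finset.univ o :=
  (pathRec_of_rootedIso φ b
    (⟨SimpleGraph.Iso.map (Fintype.equivFin V) G, rfl⟩ : RootedIso G o _ _) n).symm

/-- The isomorphism class of the ball of radius `r` around `v`. -/
noncomputable def ballClass {V : Type*} [Fintype V] (G : SimpleGraph V) (r : ℕ) (v : V) :
    RootedClass :=
  letI : Fintype (ballSet G v r) := Fintype.ofFinite _
  rootedClass (ball G v r) (ballRoot G v r)

theorem ballClass_eq_mk_iff {V : Type*} [Fintype V] {G : SimpleGraph V} {r : ℕ} {v : V} {m : ℕ}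
    {T : SimpleGraph (Fin m)} {p : Fin m} :
    ballClass G r v = RootedClass.mk T p ↔ RootedIso (ball G v r) (ballRoot G v r) T p :=
  letI : Fintype (ballSet G v r) := Fintype.ofFinite _
  rootedClass_eq_mk_iff

theorem pathRec_ballClass {M : Type*} [AddCommMonoid M] (φ : M → M) (b : M) {V : Type*}
    [Fintype V] (G : SimpleGraph V) (r : ℕ) (v : V) :
    (ballClass G r v).pathRec φ b r = pathRec φ b G r Finset.univ v := by
  let _ : Fintype (ballSet G v r) := Fintype.ofFinite _
  exact (pathRec_rootedClass φ b r _ _).trans (pathRec_ball φ b G v r)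

/-- The isomorphism class of a truncated tree. -/
noncomputable def treeClass (N : List ℕ → ℕ) (r : ℕ) : RootedClass :=
  rootedClass (truncTree N r) (treeRoot N r)

theorem treeClass_congr {N N' : List ℕ → ℕ} {r : ℕ}
    (h : ∀ w, (IsNode N w ∧ w.length ≤ r) ↔ (IsNode N' w ∧ w.length ≤ r)) :
    treeClass N r = treeClass N' r :=
  rootedClass_eq_mk_iff.2 ((rootedIso_truncTree_of_isNode_iff h).trans (rootedClass_eq_mk_iff.1 rfl))

section Convergence

variable {Ω : Type*} [MeasurableSpace Ω] {μ : Measure Ω} {N : Ω → List ℕ → ℕ} {P ρ : PMF ℕ}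

theorem IsGaltonWatson.measurableSet_isNode (hN : IsGaltonWatson μ N P ρ) (w : List ℕ) :
    MeasurableSet {ω | IsNode (N ω) w} := by
  induction w with
  | nil => exact MeasurableSet.const True
  | cons i u ih => exact (measurableSet_lt measurable_const (hN.measurable u)).inter ih

/-- The class depends only on the finite set of words that are vertices up to generation `r`. There
are countably many such sets, and each is a measurable event. -/
theorem IsGaltonWatson.measurable_treeClass (hN : IsGaltonWatson μ N P ρ) (r : ℕ) :
    Measurable fun ω => treeClass (N ω) r := by
  refine measurable_to_countable' fun q => ?_
  let nodes : Ω → Finset (List ℕ) := fun ω => (finite_nodes (N ω) r).toFinset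
  have hnodes : ∀ F : Finset (List ℕ), MeasurableSet {ω | nodes ω = F} := by
    intro F
    have h1 : {ω | nodes ω = F} = ⋂ w, {ω | (IsNode (N ω) w ∧ w.length ≤ r) ↔ w ∈ F} := by
      ext ω
      simp [nodes, Finset.ext_iff]
    rw [h1]
    refine MeasurableSet.iInter fun w => ?_
    exact ((hN.measurableSet_isNode w).inter (MeasurableSet.const _)).iff (MeasurableSet.const _)
  have h2 : (fun ω => treeClass (N ω) r) ⁻¹' {q} =
      ⋃ F ∈ {F | ∃ ω, treeClass (N ω) r = q ∧ nodes ω = F}, {ω | nodes ω = F} := by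
    ext ω
    simp only [Set.mem_preimage, Set.mem_singleton_iff, Set.mem_iUnion, exists_prop,
      Set.mem_ofPred_eq]
    constructor
    · exact fun h => ⟨_, ⟨ω, h, rfl⟩, rfl⟩
    · rintro ⟨F, ⟨ω', h, hF⟩, hω⟩
      rw [← h]
      refine treeClass_congr fun w => ?_
      have := congrArg (w ∈ ·) (hω.trans hF.symm)
      simpa [nodes] using this
  rw [h2]
  exact MeasurableSet.biUnion (Set.to_countable _) fun F _ => hnodes F

/-- Local convergence implies the convergence of averages of bounded functions of the ball. -/
theorem IsGaltonWatson.tendsto_average_ball [IsProbabilityMeasure μ]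
    (hN : IsGaltonWatson μ N P ρ) {V : ℕ → Type*} [∀ n, Fintype (V n)] [∀ n, Nonempty (V n)]
    (G : ∀ n, SimpleGraph (V n)) {r : ℕ}
    (hconv : ∀ (m : ℕ) (T : SimpleGraph (Fin m)) (o : Fin m), T.IsTree →
      (∀ v, T.edist o v ≤ (r : ℕ∞)) → Tendsto
        (fun n => (Nat.card {v : V n // RootedIso (ball (G n) v r) (ballRoot (G n) v r) T o} : ℝ) /
          Fintype.card (V n)) atTop
        (𝓝 (μ.real {ω | RootedIso (truncTree (N ω) r) (treeRoot (N ω) r) T o})))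
    {h : RootedClass → ℂ} {B : ℝ} (hB : ∀ q, ‖h q‖ ≤ B) :
    Tendsto (fun n => (∑ v, h (ballClass (G n) r v)) / (Fintype.card (V n) : ℂ)) atTop
      (𝓝 (∫ ω, h (treeClass (N ω) r) ∂μ)) := by
  refine tendsto_average_of_tendsto_frequency (fun n => ballClass (G n) r)
    (hN.measurable_treeClass r) ?_ hB
  rintro q ⟨ω, rfl⟩
  obtain ⟨⟨m, T, p⟩, hq⟩ := Quotient.exists_rep (s := rootedSetoid) (treeClass (N ω) r)
  change RootedClass.mk T p = treeClass (N ω) r at hq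
  have hiso : RootedIso (truncTree (N ω) r) (treeRoot (N ω) r) T p :=
    rootedClass_eq_mk_iff.1 hq.symm
  have hT : T.IsTree := hiso.choose.isTree_iff.1 (isTree_truncTree (N ω) r)
  have hd : ∀ v, T.edist p v ≤ (r : ℕ∞) := by
    obtain ⟨e, rfl⟩ := hiso
    intro v
    obtain ⟨w, rfl⟩ := e.surjective v
    refine (edist_iso_le e _ _).trans ((edist_treeRoot_le (N ω) r w.1 w.2).trans ?_)
    exact_mod_cast w.2.2
  have := hconv m T p hT hd
  simp only [← hq]
  simp only [ballClass_eq_mk_iff]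
  simpa only [treeClass, rootedClass_eq_mk_iff] using this

end Convergence

/-! ### Convergence of the monomer density -/

/-- A bounded pointwise limit of holomorphic functions on the right half-plane is a locally uniform
limit. -/
theorem tendstoLocallyUniformlyOn_of_tendsto {f : ℕ → ℂ → ℂ} {F : ℂ → ℂ} {K : ℝ} (hK : 0 ≤ K)
    (hf : ∀ n, DifferentiableOn ℂ (f n) rightHalfPlane)
    (hM : ∀ n, ∀ z ∈ rightHalfPlane, ‖f n z‖ ≤ K * (‖z‖ / z.re))
    (h : ∀ z ∈ rightHalfPlane, Tendsto (fun n => f n z) atTop (𝓝 (F z))) :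
    TendstoLocallyUniformlyOn f F atTop rightHalfPlane := by
  obtain ⟨F', hF'⟩ := exists_tendstoLocallyUniformlyOn (a := 0) hK hf hM
    fun z hz => (h z hz).cauchySeq
  exact hF'.congr_right fun z hz => tendsto_nhds_unique (hF'.tendsto_at hz) (h z hz)

theorem differentiableOn_of_tendsto {f : ℕ → ℂ → ℂ} {F : ℂ → ℂ} {K : ℝ} (hK : 0 ≤ K)
    (hf : ∀ n, DifferentiableOn ℂ (f n) rightHalfPlane)
    (hM : ∀ n, ∀ z ∈ rightHalfPlane, ‖f n z‖ ≤ K * (‖z‖ / z.re))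
    (h : ∀ z ∈ rightHalfPlane, Tendsto (fun n => f n z) atTop (𝓝 (F z))) :
    DifferentiableOn ℂ F rightHalfPlane :=
  (tendstoLocallyUniformlyOn_of_tendsto hK hf hM h).differentiableOn (Eventually.of_forall hf)
    isOpen_rightHalfPlane

theorem norm_mul_monomerRec_le {V : Type*} (G : SimpleGraph V) {z : ℂ} (hz : z ∈ rightHalfPlane)
    (n : ℕ) (S : Finset V) (v : V) : ‖z * monomerRec z G n S v‖ ≤ ‖z‖ / z.re := by
  rw [norm_mul, div_eq_mul_inv]
  gcongr
  exact norm_monomerRec_le hz G n S v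

/-- The error of the depth `r` approximation of the weight of a vertex. -/
theorem norm_monomerProb_sub_le {V : Type*} [Fintype V] (G : SimpleGraph V) {a : ℝ} (ha : 0 < a)
    {z : ℂ} (hz : a < z.re) (r : ℕ) (v : V) :
    ‖monomerProb G z v - z * monomerRec z G r Finset.univ v‖ ≤
      ‖z‖ * (2 * z.re⁻¹) * min 1 ((a ^ 2)⁻¹ ^ r * pathCount G r Finset.univ v) := by
  have hz0 : 0 < z.re := ha.trans hz
  rw [monomerProb_eq G hz0 v (le_max_left _ r), ← mul_sub, norm_mul, mul_assoc]
  refine mul_le_mul_of_nonneg_left ?_ (norm_nonneg z)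
  -- The cap at 1 comes from the trivial bound on two values of modulus at most `z.re⁻¹`. It makes
  -- the error estimate a bounded function of the ball.
  rw [mul_min_of_nonneg _ _ (by positivity), mul_one]
  refine le_min ?_ ?_
  · refine (norm_sub_le _ _).trans ?_
    have h1 := norm_monomerRec_le hz0 G (max (Fintype.card V) r) Finset.univ v
    have h2 := norm_monomerRec_le hz0 G r Finset.univ v
    linarith
  · refine (norm_monomerRec_sub_le hz0 G (le_max_right _ r) Finset.univ v).trans ?_
    gcongr

section Density

variable {Ω : Type*} [MeasurableSpace Ω] {μ : Measure Ω} [IsProbabilityMeasure μ]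
  {N : Ω → List ℕ → ℕ} {P ρ : PMF ℕ}
  {V : ℕ → Type*} [∀ n, Fintype (V n)] [∀ n, Nonempty (V n)] (G : ∀ n, SimpleGraph (V n))

/-- Local convergence of a deterministic sequence of graphs. -/
def ConvergesTo (μ : Measure Ω) (N : Ω → List ℕ → ℕ) : Prop :=
  ∀ (r m : ℕ) (T : SimpleGraph (Fin m)) (o : Fin m), T.IsTree →
    (∀ v, T.edist o v ≤ (r : ℕ∞)) → Tendsto
      (fun n => (Nat.card {v : V n // RootedIso (ball (G n) v r) (ballRoot (G n) v r) T o} : ℝ) /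
        Fintype.card (V n)) atTop
      (𝓝 (μ.real {ω | RootedIso (truncTree (N ω) r) (treeRoot (N ω) r) T o}))

variable {G}

theorem IsGaltonWatson.tendsto_average_monomerRec (hN : IsGaltonWatson μ N P ρ)
    (hconv : ConvergesTo G μ N) (r : ℕ) {z : ℂ} (hz : z ∈ rightHalfPlane) :
    Tendsto (fun n => (∑ v, z * monomerRec z (G n) r Finset.univ v) / (Fintype.card (V n) : ℂ))
      atTop (𝓝 (∫ ω, z * treeWeight z (N ω) r ∂μ)) := by
  have h := hN.tendsto_average_ball G (hconv r) (B := ‖z‖ / z.re)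
    (h := fun q => z * q.pathRec (fun s => (z + s)⁻¹) z⁻¹ r) (by
      rintro ⟨m, T, p⟩
      exact norm_mul_monomerRec_le T hz r _ p)
  simp only [pathRec_ballClass, treeClass, pathRec_rootedClass] at h
  simpa only [monomerRec, treeWeight, pathRec_truncTree_root (fun s => (z + s)⁻¹) z⁻¹ _
    (Or.inl le_rfl : r ≤ r ∨ _), min_self] using h

theorem IsGaltonWatson.tendsto_average_pathCount (hN : IsGaltonWatson μ N P ρ)
    (hconv : ConvergesTo G μ N) (r : ℕ) {x : ℝ} (hx : 0 ≤ x) :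
    Tendsto (fun n => (∑ v, min 1 (x * pathCount (G n) r Finset.univ v)) / Fintype.card (V n))
      atTop (𝓝 (∫ ω, min 1 (x * generationSize (N ω) r) ∂μ)) := by
  have h := hN.tendsto_average_ball G (hconv r) (B := 1)
    (h := fun q => ((min 1 (x * (q.pathRec id 1 r : ℕ)) : ℝ) : ℂ)) (by
      intro q
      rw [Complex.norm_real, Real.norm_of_nonneg (le_min zero_le_one (by positivity))]
      exact min_le_left _ _)
  simp only [pathRec_ballClass, treeClass, pathRec_rootedClass] at h
  simp only [pathRec_truncTree_root id 1 _ (Or.inl le_rfl : r ≤ r ∨ _), min_self] at h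
  rw [integral_complex_ofReal] at h
  have h1 := (Complex.continuous_re.tendsto _).comp h
  rw [Complex.ofReal_re] at h1
  refine h1.congr fun n => ?_
  rw [Function.comp_apply, ← Complex.ofReal_sum, ← Complex.ofReal_natCast, ← Complex.ofReal_div,
    Complex.ofReal_re]
  rfl

theorem IsGaltonWatson.tendsto_integral_generationSize (hN : IsGaltonWatson μ N P ρ) {a : ℝ}
    (h : ∀ᵐ ω ∂μ, Tendsto (fun n : ℕ => (a ^ 2)⁻¹ ^ n * (generationSize (N ω) n : ℝ)) atTop
      (𝓝 0)) :
    Tendsto (fun n : ℕ => ∫ ω, min 1 ((a ^ 2)⁻¹ ^ n * (generationSize (N ω) n : ℝ)) ∂μ) atTop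
      (𝓝 0) := by
  have h0 : (0 : ℝ) = ∫ _, (0 : ℝ) ∂μ := by simp
  rw [h0]
  refine tendsto_integral_of_dominated_convergence (fun _ => 1) (fun n => ?_) (integrable_const _)
    (fun n => Eventually.of_forall fun ω => ?_) ?_
  · exact ((measurable_of_countable fun k : ℕ => min 1 ((a ^ 2)⁻¹ ^ n * (k : ℝ))).comp
      (hN.measurable_generationSize n)).aestronglyMeasurable
  · rw [Real.norm_of_nonneg (le_min zero_le_one (by positivity))]
    exact min_le_left _ _
  · filter_upwards [h] with ω hω
    simpa using (tendsto_const_nhds (x := (1 : ℝ))).min hω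

theorem norm_monomerDensity_sub_le {V : Type*} [Fintype V] [Nonempty V] (G : SimpleGraph V) {a : ℝ}
    (ha : 0 < a) {z : ℂ} (hz : a < z.re) (r : ℕ) :
    ‖monomerDensity G z -
        (∑ v, z * monomerRec z G r Finset.univ v) / (Fintype.card V : ℂ)‖ ≤
      ‖z‖ * (2 * z.re⁻¹) * ((∑ v, min 1 ((a ^ 2)⁻¹ ^ r * pathCount G r Finset.univ v)) /
        Fintype.card V) := by
  rw [monomerDensity, ← sub_div, ← Finset.sum_sub_distrib, norm_div, Complex.norm_natCast,
    ← mul_div_assoc, Finset.mul_sum]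
  gcongr
  exact norm_sum_le_of_le _ fun v _ => norm_monomerProb_sub_le G ha hz r v

/-- The depth `r` is fixed first, using only the tree: both the bias of the truncated expectation
and the expected capped error are small. Local convergence at that depth then handles large `n`. -/
theorem IsGaltonWatson.tendsto_monomerDensity_of_large (hN : IsGaltonWatson μ N P ρ)
    (hconv : ConvergesTo G μ N) {a : ℝ} (ha : 0 < a)
    (h : ∀ᵐ ω ∂μ, Tendsto (fun n : ℕ => (a ^ 2)⁻¹ ^ n * (generationSize (N ω) n : ℝ)) atTop (𝓝 0))
    {z : ℂ} (hz : a < z.re) :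
    Tendsto (fun n => monomerDensity (G n) z) atTop (𝓝 (∫ ω, treeLimit (N ω) z ∂μ)) := by
  have hz0 : z ∈ rightHalfPlane := ha.trans hz
  have hI := hN.tendsto_integral_treeWeight hz0 (h.mono fun ω hω => tendsto_treeLimit ha hω hz0)
  have hm := (hN.tendsto_integral_generationSize h).const_mul (‖z‖ * (2 * z.re⁻¹))
  rw [mul_zero] at hm
  rw [Metric.tendsto_nhds]
  intro ε hε
  have hε3 : 0 < ε / 3 := by positivity
  obtain ⟨r, hr1, hr2⟩ := ((Metric.tendsto_nhds.1 hI (ε / 3) hε3).and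
    (hm.eventually_lt_const hε3)).exists
  have hA := Metric.tendsto_nhds.1 (hN.tendsto_average_monomerRec hconv r hz0) (ε / 3) hε3
  have hB := ((hN.tendsto_average_pathCount hconv r (x := (a ^ 2)⁻¹ ^ r)
    (by positivity)).const_mul (‖z‖ * (2 * z.re⁻¹))).eventually_lt_const hr2
  filter_upwards [hA, hB] with n hn1 hn2
  have h1 := (norm_monomerDensity_sub_le (G n) ha hz r).trans_lt hn2
  rw [← dist_eq_norm] at h1
  have t1 := dist_triangle (monomerDensity (G n) z)
    ((∑ v, z * monomerRec z (G n) r Finset.univ v) / (Fintype.card (V n) : ℂ))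
    (∫ ω, treeLimit (N ω) z ∂μ)
  have t2 := dist_triangle
    ((∑ v, z * monomerRec z (G n) r Finset.univ v) / (Fintype.card (V n) : ℂ))
    (∫ ω, z * treeWeight z (N ω) r ∂μ) (∫ ω, treeLimit (N ω) z ∂μ)
  linarith

theorem norm_integral_treeWeight_le {z : ℂ} (hz : z ∈ rightHalfPlane) (r : ℕ) :
    ‖∫ ω, z * treeWeight z (N ω) r ∂μ‖ ≤ ‖z‖ / z.re := by
  have := norm_integral_le_of_norm_le_const (μ := μ)
    (Eventually.of_forall fun ω => norm_mul_treeWeight_le hz (N ω) r)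
  simpa using this

/-- Differentiation under the integral is avoided: the expectation at depth `r` is a limit of vertex
averages on the graphs, which are finite sums of holomorphic functions, and a second bounded limit
in `r` keeps holomorphy. -/
theorem IsGaltonWatson.differentiableOn_integral_treeLimit (hN : IsGaltonWatson μ N P ρ)
    (hconv : ConvergesTo G μ N)
    (h : ∀ᵐ ω ∂μ, ∀ z ∈ rightHalfPlane,
      Tendsto (fun r : ℕ => monomerProb (truncTree (N ω) r) z (treeRoot (N ω) r)) atTop
        (𝓝 (treeLimit (N ω) z))) :
    DifferentiableOn ℂ (fun z => ∫ ω, treeLimit (N ω) z ∂μ) rightHalfPlane := by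
  refine differentiableOn_of_tendsto (f := fun r z => ∫ ω, z * treeWeight z (N ω) r ∂μ)
    zero_le_one (fun r => ?_) (fun r z hz => ?_)
    fun z hz => hN.tendsto_integral_treeWeight hz (h.mono fun ω hω => hω z hz)
  · refine differentiableOn_of_tendsto zero_le_one (fun n => ?_) (fun n z hz => ?_)
      fun z hz => hN.tendsto_average_monomerRec hconv r hz
    · exact (DifferentiableOn.fun_sum fun v _ =>
        differentiableOn_id.mul (differentiableOn_monomerRec (G n) r Finset.univ v)).div_const _
    · rw [one_mul]
      exact norm_average_le fun v => norm_mul_monomerRec_le (G n) hz r _ v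
  · rw [one_mul]
    exact norm_integral_treeWeight_le hz r

theorem norm_integral_treeLimit_le
    (hN : IsGaltonWatson μ N P ρ) {z : ℂ} (hz : z ∈ rightHalfPlane)
    (h : ∀ᵐ ω ∂μ, Tendsto (fun r : ℕ => monomerProb (truncTree (N ω) r) z (treeRoot (N ω) r)) atTop
        (𝓝 (treeLimit (N ω) z))) :
    ‖∫ ω, treeLimit (N ω) z ∂μ‖ ≤ ‖z‖ / z.re :=
  le_of_tendsto (hN.tendsto_integral_treeWeight hz h).norm
    (Eventually.of_forall fun r => norm_integral_treeWeight_le hz r)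

/-- The monomer densities converge locally uniformly on the right half-plane. -/
theorem IsGaltonWatson.tendstoLocallyUniformlyOn_monomerDensity (hN : IsGaltonWatson μ N P ρ)
    (hconv : ConvergesTo G μ N) {a : ℝ} (ha : 0 < a)
    (h : ∀ᵐ ω ∂μ, Tendsto (fun n : ℕ => (a ^ 2)⁻¹ ^ n * (generationSize (N ω) n : ℝ)) atTop
      (𝓝 0)) :
    TendstoLocallyUniformlyOn (fun n => monomerDensity (G n))
      (fun z => ∫ ω, treeLimit (N ω) z ∂μ) atTop rightHalfPlane := by
  have hlim : ∀ᵐ ω ∂μ, ∀ z ∈ rightHalfPlane,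
      Tendsto (fun r : ℕ => monomerProb (truncTree (N ω) r) z (treeRoot (N ω) r)) atTop
        (𝓝 (treeLimit (N ω) z)) := h.mono fun ω hω z hz => tendsto_treeLimit ha hω hz
  have hz := tendstoLocallyUniformlyOn_zero (l := atTop) (a := a) (K := 2) zero_le_two
    (f := fun n z => monomerDensity (G n) z - ∫ ω, treeLimit (N ω) z ∂μ)
    (fun n => (differentiableOn_monomerDensity (G n)).sub
      (hN.differentiableOn_integral_treeLimit hconv hlim))
    (fun n z hz => by
      refine (norm_sub_le _ _).trans ?_
      have h1 := norm_monomerDensity_le (G n) hz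
      have h2 := norm_integral_treeLimit_le hN hz (hlim.mono fun ω hω => hω z hz)
      linarith)
    (fun z hz => by
      simpa using (hN.tendsto_monomerDensity_of_large hconv ha h hz).sub_const
        (∫ ω, treeLimit (N ω) z ∂μ))
  rw [Metric.tendstoLocallyUniformlyOn_iff] at hz ⊢
  intro ε hε x hx
  obtain ⟨t, ht, h'⟩ := hz ε hε x hx
  refine ⟨t, ht, h'.mono fun n hn y hy => ?_⟩
  have := hn y hy
  rwa [Pi.zero_apply, dist_zero_left, ← dist_eq_norm, dist_comm] at this

end Density

/-- Dividing a locally uniformly convergent sequence on the right half-plane by the variable. -/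
theorem tendstoLocallyUniformlyOn_div_id {f : ℕ → ℂ → ℂ} {F : ℂ → ℂ}
    (h : TendstoLocallyUniformlyOn f F atTop rightHalfPlane) :
    TendstoLocallyUniformlyOn (fun n z => f n z / z) (fun z => F z / z) atTop rightHalfPlane := by
  rw [Metric.tendstoLocallyUniformlyOn_iff] at h ⊢
  intro ε hε x hx
  have hx : 0 < x.re := hx
  obtain ⟨t, ht, h'⟩ := h (ε * (x.re / 2)) (by positivity) x hx
  have hu : {z : ℂ | x.re / 2 < z.re} ∈ 𝓝 x :=
    (isOpen_lt continuous_const Complex.continuous_re).mem_nhds (half_lt_self hx)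
  refine ⟨t ∩ {z : ℂ | x.re / 2 < z.re}, inter_mem ht (mem_nhdsWithin_of_mem_nhds hu),
    h'.mono fun n hn y hy => ?_⟩
  have h1 := hn y hy.1
  have h2 : x.re / 2 < ‖y‖ := lt_of_lt_of_le hy.2 (Complex.re_le_norm y)
  rw [dist_eq_norm] at h1 ⊢
  rw [← sub_div, norm_div, div_lt_iff₀ (by linarith)]
  exact h1.trans (by gcongr)

/-- The identity between the density and the derivative of the pressure holds on an open set that
avoids 0, so it can be divided by `w` and differentiated further. -/
theorem iteratedDeriv_pressure {V : Type*} [Fintype V] (G : SimpleGraph V) {L : ℂ → ℂ}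
    (hL : IsLogPartition G L) (k : ℕ) {z : ℂ} (hz : z ∈ rightHalfPlane) :
    iteratedDeriv (k + 1) (fun w => L w / (Fintype.card V : ℂ)) z =
      iteratedDeriv k (fun w => monomerDensity G w / w) z := by
  rw [iteratedDeriv_succ']
  refine Filter.EventuallyEq.iteratedDeriv_eq k ?_
  filter_upwards [isOpen_rightHalfPlane.mem_nhds hz] with w hw
  have hw0 : w ≠ 0 := fun h0 => by simp [rightHalfPlane, h0] at hw
  rw [monomerDensity_eq G hL hw, mul_div_cancel_left₀ _ hw0]

end MonomerDimer

theorem mainTheorem5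
    {Ω : Type*} [MeasurableSpace Ω] (μ : MeasureTheory.Measure Ω)
    [MeasureTheory.IsProbabilityMeasure μ]
    {V : ℕ → Ω → Type*} [∀ n ω, Fintype (V n ω)] [∀ n ω, Nonempty (V n ω)]
    (G : ∀ n ω, SimpleGraph (V n ω))
    {Ω' : Type*} [MeasurableSpace Ω'] (μ' : MeasureTheory.Measure Ω')
    [MeasureTheory.IsProbabilityMeasure μ']
    (N : Ω' → List ℕ → ℕ) (P ρ : PMF ℕ)
    (hN : MonomerDimer.IsGaltonWatson μ' N P ρ)
    (hunim : MonomerDimer.IsUnimodular P ρ)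
    (hconv : MonomerDimer.LocallyConverges μ G μ' N)
    (hsecond : ∑' k : ℕ, (k : ℝ≥0∞) ^ 2 * P k ≠ ⊤) :
    -- the limit defining `Y(z)` exists almost surely for all `z`, and `Y(z)` is integrable
    (∀ᵐ ω' ∂μ', ∀ z ∈ MonomerDimer.rightHalfPlane,
      Tendsto (fun r : ℕ => MonomerDimer.monomerProb (MonomerDimer.truncTree (N ω') r) z
          (MonomerDimer.treeRoot (N ω') r))
        atTop (𝓝 (MonomerDimer.treeLimit (N ω') z))) ∧
    (∀ z ∈ MonomerDimer.rightHalfPlane,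
      Integrable (fun ω' => MonomerDimer.treeLimit (N ω') z) μ') ∧
    -- `log Z` is well defined on the half-plane, and the two expressions of the density agree
    (∀ n ω, ∃ L : ℂ → ℂ, MonomerDimer.IsLogPartition (G n ω) L) ∧
    (∀ n ω, ∀ L : ℂ → ℂ, MonomerDimer.IsLogPartition (G n ω) L →
      ∀ z ∈ MonomerDimer.rightHalfPlane,
        MonomerDimer.monomerDensity (G n ω) z =
          z * deriv (fun w => L w / (Fintype.card (V n ω) : ℂ)) z) ∧
    -- almost sure convergence of the density, pointwise and uniformly on compact sets
    (∀ᵐ ω ∂μ,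
      (∀ z ∈ MonomerDimer.rightHalfPlane,
        Tendsto (fun n => MonomerDimer.monomerDensity (G n ω) z) atTop
          (𝓝 (∫ ω', MonomerDimer.treeLimit (N ω') z ∂μ'))) ∧
      ∀ K : Set ℂ, K ⊆ MonomerDimer.rightHalfPlane → IsCompact K →
        TendstoUniformlyOn (fun n z => MonomerDimer.monomerDensity (G n ω) z)
          (fun z => ∫ ω', MonomerDimer.treeLimit (N ω') z ∂μ') atTop K) ∧
    AnalyticOnNhd ℂ (fun z => ∫ ω', MonomerDimer.treeLimit (N ω') z ∂μ')
      MonomerDimer.rightHalfPlane ∧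
    -- almost sure convergence of all derivatives of the pressure per particle
    (∀ᵐ ω ∂μ, ∀ L : ℕ → ℂ → ℂ, (∀ n, MonomerDimer.IsLogPartition (G n ω) (L n)) →
      ∀ k : ℕ, 1 ≤ k → ∀ z ∈ MonomerDimer.rightHalfPlane,
        Tendsto (fun n => iteratedDeriv k (fun w => L n w / (Fintype.card (V n ω) : ℂ)) z) atTop
          (𝓝 (iteratedDeriv (k - 1)
            (fun w => (∫ ω', MonomerDimer.treeLimit (N ω') w ∂μ') / w) z))) := by
  obtain ⟨a, ha, hsum⟩ := hN.exists_sum_lintegral_lt_top hunim hsecond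
  have hgen := hN.ae_tendsto_generationSize hsum
  have hlim : ∀ᵐ ω' ∂μ', ∀ z ∈ MonomerDimer.rightHalfPlane,
      Tendsto (fun r : ℕ => MonomerDimer.monomerProb (MonomerDimer.truncTree (N ω') r) z
          (MonomerDimer.treeRoot (N ω') r))
        atTop (𝓝 (MonomerDimer.treeLimit (N ω') z)) :=
    hgen.mono fun ω' hω' z hz => MonomerDimer.tendsto_treeLimit ha hω' hz
  -- There are countably many radii and finite rooted trees on `Fin m`, so the exceptional null sets
  -- merge into one.
  have hall : ∀ᵐ ω ∂μ, MonomerDimer.ConvergesTo (fun n => G n ω) μ' N := by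
    simp only [MonomerDimer.ConvergesTo, ae_all_iff]
    exact hconv
  have hunif : ∀ᵐ ω ∂μ, TendstoLocallyUniformlyOn
      (fun n z => MonomerDimer.monomerDensity (G n ω) z)
      (fun z => ∫ ω', MonomerDimer.treeLimit (N ω') z ∂μ') atTop MonomerDimer.rightHalfPlane :=
    hall.mono fun ω hω => hN.tendstoLocallyUniformlyOn_monomerDensity hω ha hgen
  refine ⟨hlim, fun z hz => hN.integrable_treeLimit hz (hlim.mono fun ω' h => h z hz),
    fun n ω => MonomerDimer.exists_isLogPartition (G n ω),
    fun n ω L hL z hz => MonomerDimer.monomerDensity_eq (G n ω) hL hz, ?_, ?_, ?_⟩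
  · filter_upwards [hunif] with ω hω
    exact ⟨fun z hz => hω.tendsto_at hz, fun K hK hKc =>
      (tendstoLocallyUniformlyOn_iff_forall_isCompact MonomerDimer.isOpen_rightHalfPlane).1
        hω K hK hKc⟩
  -- The claim concerns only the tree, but its proof needs one convergent realisation of the graphs,
  -- which an almost sure event supplies.
  · obtain ⟨ω, hω⟩ := hall.exists
    exact (hN.differentiableOn_integral_treeLimit hω hlim).analyticOnNhd
      MonomerDimer.isOpen_rightHalfPlane
  · filter_upwards [hunif] with ω hω L hL k hk z hz
    obtain ⟨k, rfl⟩ : ∃ j, k = j + 1 := ⟨k - 1, by omega⟩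
    simp only [MonomerDimer.iteratedDeriv_pressure _ (hL _) k hz, Nat.add_sub_cancel]
    refine (MonomerDimer.tendstoLocallyUniformlyOn_iteratedDeriv MonomerDimer.isOpen_rightHalfPlane
      (fun n => ?_) (MonomerDimer.tendstoLocallyUniformlyOn_div_id hω) k).tendsto_at hz
    exact (MonomerDimer.differentiableOn_monomerDensity (G n ω)).div differentiableOn_id
      fun w hw h0 => by simp [MonomerDimer.rightHalfPlane, h0] at hw
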